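/- Let $\Gamma$ be a connected trivalent fatgraph (a finite connected graph, loops and multiple edges allowed, with all vertices of valence $3$ and a cyclic order of the edge ends at each vertex) that is the spine of a surface of genus $g$ with $n$ punctures. Put $V=4g-4+2n$ and $N=6g-6+3n$ (the numbers of vertices and of edges of $\Gamma$) and $m=3g-3+n$. Let $\lambda=(\lambda(e))_e\in\mathbb R_{>0}^{N}$ be the $\lambda$-length coordinates, one for each edge. The simplicial coordinate of an edge $e$ is $$X_e=\sum_{i=1}^{2}\left(\frac{\lambda(f_i)}{\lambda(e)\lambda(g_i)}+\frac{\lambda(g_i)}{\lambda(e)\lambda(f_i)}-\frac{\lambda(e)}{\lambda(f_i)\lambda(g_i)}\right),$$ where $f_i,g_i$ are the other two edges at the $i$-th end of $e$. For each puncture $i$, let $\rho_i$ be the sum of the $X_e$ along the closed edge path of $\Gamma$ around that puncture (an edge traversed twice is counted twice). Let $$D(\Gamma)=\{\lambda\in\mathbb R_{>0}^N:\ \rho_i=1\ \text{for all } i,\ X_e>0\ \text{for all } e\},$$ and let $$\omega_{WP}=-2\sum_{v}\bigl(d\ln\lambda(e)\wedge d\ln\lambda(f)+d\ln\lambda(f)\wedge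 d\ln\lambda(g)+d\ln\lambda(g)\wedge d\ln\lambda(e)\bigr),$$ where $e,f,g$ are the edges at the vertex $v$ in their cyclic order. Let $\Omega=\frac1{m!}\,\omega_{WP}\wedge\cdots\wedge\omega_{WP}$ ($m$ factors) be the Weil-Petersson volume form. Then the integral of the density $|\Omega|$ over $D(\Gamma)$, that is, the integral of $\Omega$ for the orientation of $D(\Gamma)$ in which $\Omega$ is positive, satisfies $$\int_{D(\Gamma)}|\Omega|<2^N\,3^V N^n\left(\frac83\right)^{(N-1)/2}(2V)^n .$$ If $n=1$, then moreover $$\int_{D(\Gamma)}|\Omega|<2^{4g-2}\,3^V\left(\frac83\right)^{(N-1)/2}N .$$ -/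

import Mathlib

open scoped ENNReal

/-- A connected trivalent embedded graph (fatgraph) on a finite set `H` of half-edges: `next` moves
a half-edge to the following one in the cyclic order around its vertex (all vertices have valence
three), and `flip` exchanges the two ends of each edge. Loops and multiple edges are allowed. -/
structure TrivalentFatgraph (H : Type*) where
  next : Equiv.Perm H
  flip : Equiv.Perm H
  next_next_next : ∀ h, next (next (next h)) = h
  next_ne : ∀ h, next h ≠ h
  flip_flip : ∀ h, flip (flip h) = h
  flip_ne : ∀ h, flip h ≠ h
  nonempty : Nonempty H
  connected : ∀ h h' : H, ∃ p ∈ Subgroup.closure {next, flip}, p h = h'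

namespace TrivalentFatgraph

variable {H : Type*} (Γ : TrivalentFatgraph H)

/-- The vertices: the cycles of `next`. -/
def Vertex : Type _ := Quotient (Equiv.Perm.SameCycle.setoid Γ.next)

/-- The edges: the cycles of `flip`. -/
def Edge : Type _ := Quotient (Equiv.Perm.SameCycle.setoid Γ.flip)

/-- The faces (punctures): the cycles of the permutation that runs along an edge to its other end
and then turns to the next half-edge there. -/
def Face : Type _ := Quotient (Equiv.Perm.SameCycle.setoid (Γ.next * Γ.flip))

/-- The edge containing a half-edge. -/
def edge (h : H) : Γ.Edge := Quotient.mk _ h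

/-- The face whose boundary path traverses the edge of `h`, starting from `h`. -/
def face (h : H) : Γ.Face := Quotient.mk _ h

/-- `Γ` is the spine of a surface of genus `g` with `n` punctures. -/
def HasType (g n : ℕ) : Prop :=
  Nat.card Γ.Face = n ∧
    (Nat.card Γ.Vertex : ℤ) - (Nat.card Γ.Edge : ℤ) + (n : ℤ) = 2 - 2 * (g : ℤ)

variable [Fintype H]

noncomputable instance : Fintype Γ.Edge :=
  haveI : Finite Γ.Edge := Quotient.finite _
  Fintype.ofFinite _

open Classical in
/-- The simplicial coordinate `X_e = ∑ (f/(e g) + g/(e f) - e/(f g))`, the sum being over the two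
ends of `e`, where `f` and `g` are the other two edges at that end. -/
noncomputable def simplicialCoord (lam : Γ.Edge → ℝ) (e : Γ.Edge) : ℝ :=
  ∑ h : H with Γ.edge h = e,
    (lam (Γ.edge (Γ.next h)) / (lam e * lam (Γ.edge (Γ.next (Γ.next h))))
      + lam (Γ.edge (Γ.next (Γ.next h))) / (lam e * lam (Γ.edge (Γ.next h)))
      - lam e / (lam (Γ.edge (Γ.next h)) * lam (Γ.edge (Γ.next (Γ.next h)))))

open Classical in
/-- `ρ_i`: the sum of the simplicial coordinates of the edges along the boundary path of face `i`;
an edge that the path traverses twice is counted twice. -/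
noncomputable def rho (lam : Γ.Edge → ℝ) (i : Γ.Face) : ℝ :=
  ∑ h : H with Γ.face h = i, Γ.simplicialCoord lam (Γ.edge h)

/-- The cell `D(Γ)` in the `λ`-length coordinates. -/
def cell : Set (Γ.Edge → ℝ) :=
  {lam | (∀ e, 0 < lam e) ∧ (∀ i, Γ.rho lam i = 1) ∧ ∀ e, 0 < Γ.simplicialCoord lam e}

/-- `d ln λ(e)` at the point `lam`, applied to the tangent vector `u`. -/
noncomputable def dlog (lam : Γ.Edge → ℝ) (e : Γ.Edge) (u : Γ.Edge → ℝ) : ℝ := u e / lam e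

/-- The Weil-Petersson two-form
`-2 ∑_v (dln e ∧ dln f + dln f ∧ dln g + dln g ∧ dln e)`, with `e, f, g` the edges at `v` in their
cyclic order, at the point `lam`, applied to the tangent vectors `u, w`. The three summands at a
vertex correspond to its three half-edges. -/
noncomputable def omegaWP (lam : Γ.Edge → ℝ) (u w : Γ.Edge → ℝ) : ℝ :=
  -2 * ∑ h : H,
    (Γ.dlog lam (Γ.edge h) u * Γ.dlog lam (Γ.edge (Γ.next h)) w
      - Γ.dlog lam (Γ.edge h) w * Γ.dlog lam (Γ.edge (Γ.next h)) u)

end TrivalentFatgraph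

/-- The `m`-fold exterior product `β ∧ ⋯ ∧ β` of an alternating two-form `β`, applied to `2 m`
vectors, in the normalization `(dx₁ ∧ ⋯ ∧ dx_k) (∂₁, …, ∂_k) = 1`. -/
noncomputable def wedgePow {E : Type*} (β : E → E → ℝ) (m : ℕ) (v : Fin (2 * m) → E) : ℝ :=
  (1 / 2 ^ m) * ∑ s : Equiv.Perm (Fin (2 * m)), ((Equiv.Perm.sign s : ℤ) : ℝ) *
    ∏ j : Fin m, β (v (s ⟨2 * j, by omega⟩)) (v (s ⟨2 * j + 1, by omega⟩))

/-- The integral of the density `|η|` of a `k`-form `η` over a `k`-dimensional submanifold `D`: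
the supremum of the sums `∑ⱼ ∫_{Uⱼ} |φⱼ^* η|` over all sequences of injective `C¹` parametrizations
`φⱼ : Uⱼ → D`, `Uⱼ ⊆ ℝᵏ` open (possibly empty), with pairwise disjoint images. If `η` is nowhere
zero on `D`, this is the integral of `η` over `D` with the orientation that makes `η` positive;
in all cases it bounds the absolute value of the integral of `η` over `D` for any orientation. -/
noncomputable def integralDensity {E : Type*} [NormedAddCommGroup E] [NormedSpace ℝ E] {k : ℕ}
    (D : Set E) (η : E → (Fin k → E) → ℝ) : ℝ≥0∞ :=
  ⨆ (U : ℕ → Set (Fin k → ℝ)) (φ : ℕ → (Fin k → ℝ) → E)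
    (_ : ∀ j, IsOpen (U j) ∧ ContDiffOn ℝ 1 (φ j) (U j) ∧ Set.InjOn (φ j) (U j) ∧
      Set.MapsTo (φ j) (U j) D)
    (_ : Pairwise fun i j => Disjoint (φ i '' U i) (φ j '' U j)),
    ∑' j, ∫⁻ x in U j, ENNReal.ofReal
      |η (φ j x) fun i => fderiv ℝ (φ j) x (Pi.single i 1)|

namespace TrivalentFatgraph

/-- The integral over the cell `D(Γ)` of the Weil-Petersson volume form
`ω_WP ∧ ⋯ ∧ ω_WP / m!` (`m` factors). -/
noncomputable def cellVolume {H : Type*} [Fintype H] (Γ : TrivalentFatgraph H) (m : ℕ) : ℝ≥0∞ :=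
  integralDensity Γ.cell fun lam (v : Fin (2 * m) → (Γ.Edge → ℝ)) =>
    wedgePow (Γ.omegaWP lam) m v / (m.factorial : ℝ)

end TrivalentFatgraph

/-!
The Weil-Petersson form is a sum over the vertices: at a vertex with edges `e, f, g` it is `-2` times
the area form of the plane of shapes of the dual triangle, with coordinates `ln (λ(e) / λ(g))` and
`ln (λ(f) / λ(g))` (`omegaWP_eq_sum_vertex`). Its `m`-th exterior power, divided by `m!`, is therefore
up to sign `2 ^ m` times the sum, over the sets of `m` vertices, of the products of their area forms
(`wedgePow_sum_decomposable`, `abs_wedgePow_omegaWP_le`). Such a product is the pullback of the volume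
form of `ℝ ^ (2 m)` under the map `shapeMap`, which records the shapes at the chosen vertices. Its
integral over the cell is bounded by the volume of a region that contains the image of the cell, times
the number of points of the cell that can have the same image.

* On the cell all triangles satisfy the triangle inequalities (`lt_add_of_mem_cell`): at a longest
  edge for which they fail, the positive simplicial coordinate would produce a longer one. The
  image of the cell thus lies in the `m`-th power of the space of triangle shapes, whose area is
  `π ^ 2 / 2`; the bound `5` for it is enough (`volume_triangleShapes_le`).

* For given shapes at the chosen vertices, the `λ`-lengths solve `2 m` linear equations and the `n`
  equations `ρ_i = 1`, of degree at most `2 N` after multiplication by the squares of all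
  `λ`-lengths. As `N = 2 m + n`, this is a square system, and by Bézout's bound for nondegenerate real
  zeros (`MvPolynomial.card_nondegenerate_zeros_le`) it has at most `(2 N) ^ n` solutions of the kind
  that matters (`card_le_of_shapeMap_eq`). Points of the cell where `shapeMap` is a local
  diffeomorphism are nondegenerate since the `ρ_i` are independent: `ρ_i` is twice the sum of the
  horocyclic lengths of the corners of the face `i` (`rho_eq_sum_corner`), and it alone is rescaled
  when the horocycle at that face is moved (`rho_scale`).

The area formula with bounded multiplicity (`tsum_lintegral_abs_det_fderiv_le`) combines these into
the bound `C(V, m) * 10 ^ m * (2 N) ^ n` for the volume (`cellVolume_le`), which is smaller than both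
bounds that are claimed.

Bézout's bound is proved by counting dimensions. Polynomials that interpolate the indicator functions
of `M` nondegenerate zeros of `f` are linearly independent over the polynomials in the `f i`, by the
inverse function theorem; so the products of the former with monomials in the latter, of degree at
most `D`, are about `M / ∏ dᵢ` times as many as there are monomials of degree at most `D`, and they
are linearly independent.
-/

/-! ### A Bézout bound for nondegenerate real zeros -/

namespace MvPolynomial

variable {ι : Type*}

theorem contDiff_eval [Fintype ι] (p : MvPolynomial ι ℝ) {n : WithTop ℕ∞} :
    ContDiff ℝ n fun x : ι → ℝ => eval x p := by
  induction p using MvPolynomial.induction_on with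
  | C a => simpa using contDiff_const
  | add p q hp hq => simpa using hp.add hq
  | mul_X p i hp => simpa using hp.mul (contDiff_apply ℝ ℝ i)

/-- Lagrange interpolation: a polynomial that is `1` at `z` and vanishes on the rest of `Z`. -/
theorem exists_eval_eq_ite (Z : Finset (ι → ℝ)) (z : ι → ℝ) :
    ∃ p : MvPolynomial ι ℝ, eval z p = 1 ∧ ∀ w ∈ Z, w ≠ z → eval w p = 0 := by
  classical
  have key : ∀ w : ι → ℝ, ∃ q : MvPolynomial ι ℝ, eval z q = 1 ∧ (w ≠ z → eval w q = 0) := by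
    intro w
    by_cases h : w = z
    · exact ⟨1, by simp, fun h' => absurd h h'⟩
    · obtain ⟨i, hi⟩ := Function.ne_iff.mp h
      refine ⟨C (z i - w i)⁻¹ * (X i - C (w i)), ?_, fun _ => by simp⟩
      have : z i - w i ≠ 0 := sub_ne_zero.mpr (Ne.symm hi)
      simp [this]
  choose q hq1 hq0 using key
  refine ⟨∏ w ∈ Z, q w, by simp [map_prod, hq1], fun w hw hwz => ?_⟩
  rw [map_prod]
  exact Finset.prod_eq_zero hw (hq0 w hwz)

theorem eval_aeval (f : ι → MvPolynomial ι ℝ) (p : MvPolynomial ι ℝ) (x : ι → ℝ) :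
    eval x (aeval f p) = eval (fun i => eval x (f i)) p := by
  induction p using MvPolynomial.induction_on with
  | C a => simp
  | add p q hp hq => rw [map_add, map_add, hp, hq, map_add]
  | mul_X p i hp => rw [map_mul, map_mul, hp, map_mul, aeval_X, eval_X]

/-- Polynomials that vanish near a point are zero. -/
theorem eq_zero_of_eventually_eval_eq_zero [Fintype ι] (p : MvPolynomial ι ℝ) (y₀ : ι → ℝ)
    (h : ∀ᶠ y in nhds y₀, eval y p = 0) : p = 0 := by
  obtain ⟨ε, hε, hball⟩ := Metric.eventually_nhds_iff_ball.mp h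
  refine funext_set (fun i => Metric.ball (y₀ i) ε) (fun i => ?_) fun x hx => ?_
  · rw [Real.ball_eq_Ioo]
    exact Set.Ioo_infinite (by linarith)
  · rw [map_zero]
    refine hball x ?_
    rw [ball_pi _ hε]
    exact hx

/-- Near each nondegenerate zero `z` of `f` there is a local right inverse of `f`. -/
theorem exists_local_rightInverse [Fintype ι] (f : ι → MvPolynomial ι ℝ) (z : ι → ℝ)
    (hz : ∀ i, eval z (f i) = 0)
    (hnd : ∀ u, (∀ i, fderiv ℝ (fun x => eval x (f i)) z u = 0) → u = 0) :
    ∃ ψ : (ι → ℝ) → (ι → ℝ), Filter.Tendsto ψ (nhds 0) (nhds z) ∧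
      ∀ᶠ y in nhds (0 : ι → ℝ), (fun i => eval (ψ y) (f i)) = y := by
  set F : (ι → ℝ) → (ι → ℝ) := fun x i => eval x (f i) with hF
  have hFd : ContDiff ℝ 1 F := contDiff_pi.2 fun i => contDiff_eval (f i)
  have hst : HasStrictFDerivAt F (fderiv ℝ F z) z :=
    hFd.contDiffAt.hasStrictFDerivAt (by simp)
  have hcomp : ∀ u i, fderiv ℝ F z u i = fderiv ℝ (fun x => eval x (f i)) z u := by
    intro u i
    have := hasFDerivAt_pi'.1 hst.hasFDerivAt i
    rw [this.fderiv]
    rfl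
  have hinj : Function.Injective (fderiv ℝ F z) := by
    rw [injective_iff_map_eq_zero]
    intro u hu
    refine hnd u fun i => ?_
    rw [← hcomp, hu]
    rfl
  let e : (ι → ℝ) ≃L[ℝ] (ι → ℝ) :=
    (LinearEquiv.ofInjectiveEndo (fderiv ℝ F z : (ι → ℝ) →ₗ[ℝ] (ι → ℝ))
      hinj).toContinuousLinearEquiv
  have he : (e : (ι → ℝ) →L[ℝ] (ι → ℝ)) = fderiv ℝ F z := by
    ext u
    rfl
  rw [← he] at hst
  have h0 : F z = 0 := _root_.funext hz
  refine ⟨hst.localInverse F e z, ?_, ?_⟩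
  · have := hst.localInverse_tendsto
    rwa [h0] at this
  · have := hst.eventually_right_inverse
    rwa [h0] at this

/-- If `f` has the nondegenerate zeros `Z` and the polynomials `p z` interpolate the indicator
functions of the points of `Z`, then the `p z` are linearly independent over the algebra generated
by the `f i`, and these are algebraically independent. -/
theorem eq_zero_of_sum_aeval_mul_eq_zero [Fintype ι] (f : ι → MvPolynomial ι ℝ)
    (Z : Finset (ι → ℝ)) (hz : ∀ z ∈ Z, ∀ i, eval z (f i) = 0)
    (hnd : ∀ z ∈ Z, ∀ u, (∀ i, fderiv ℝ (fun x => eval x (f i)) z u = 0) → u = 0)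
    (p : Z → MvPolynomial ι ℝ) (hp1 : ∀ z : Z, eval z.1 (p z) = 1)
    (hp0 : ∀ z w : Z, w ≠ z → eval w.1 (p z) = 0)
    (c : Z → MvPolynomial ι ℝ) (hc : ∑ z, aeval f (c z) * p z = 0) (z : Z) : c z = 0 := by
  classical
  have hψ := fun z : Z => exists_local_rightInverse f z.1 (hz z.1 z.2) (hnd z.1 z.2)
  choose ψ hψ1 hψ2 using hψ
  -- The values of the `p z` on the local branches `ψ w` of the inverse of `f` form a matrix that is
  -- the identity at `y = 0`, hence invertible nearby, and it annihilates the vector `c`.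
  let A : (ι → ℝ) → Matrix Z Z ℝ := fun y => Matrix.of fun w z => eval (ψ w y) (p z)
  have hA : Filter.Tendsto A (nhds 0) (nhds 1) := by
    refine tendsto_pi_nhds.2 fun w => tendsto_pi_nhds.2 fun z => ?_
    have h1 : Filter.Tendsto (fun y => eval (ψ w y) (p z)) (nhds 0) (nhds (eval w.1 (p z))) :=
      ((contDiff_eval (n := 1) (p z)).continuous.tendsto _).comp (hψ1 w)
    have h2 : eval w.1 (p z) = (1 : Matrix Z Z ℝ) w z := by
      by_cases h : w = z
      · subst h; simp [hp1]
      · simp [hp0 z w h, h]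
    rwa [h2] at h1
  have hdet : ∀ᶠ y in nhds (0 : ι → ℝ), (A y).det ≠ 0 := by
    have h1 : Filter.Tendsto (fun y => (A y).det) (nhds 0) (nhds (Matrix.det 1)) :=
      ((continuous_id.matrix_det).tendsto (1 : Matrix Z Z ℝ)).comp hA
    rw [Matrix.det_one] at h1
    exact h1.eventually_ne one_ne_zero
  refine eq_zero_of_eventually_eval_eq_zero _ 0 ?_
  filter_upwards [hdet, Filter.eventually_all.2 hψ2] with y hy1 hy2
  have h3 : (A y).mulVec (fun z => eval y (c z)) = 0 := by
    ext w
    have := congrArg (eval (ψ w y)) hc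
    simp only [map_sum, map_mul, eval_aeval, hy2 w, map_zero] at this
    simp only [Matrix.mulVec, dotProduct, A, Matrix.of_apply, Pi.zero_apply]
    rw [← this]
    exact Finset.sum_congr rfl fun z _ => mul_comm _ _
  exact congrFun (Matrix.eq_zero_of_mulVec_eq_zero hy1 h3) z

/-- Substituting polynomials of degree at most `d i` multiplies weights by at most `d i`. -/
theorem totalDegree_aeval_le [Fintype ι] (f : ι → MvPolynomial ι ℝ) (d : ι → ℕ)
    (hd : ∀ i, (f i).totalDegree ≤ d i) (D : ℕ) (c : MvPolynomial ι ℝ)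
    (hc : ∀ a ∈ c.support, ∑ i, d i * a i ≤ D) : (aeval f c).totalDegree ≤ D := by
  rw [aeval_def, eval₂_eq']
  refine totalDegree_finsetSum_le fun a ha => ?_
  refine (totalDegree_mul _ _).trans ?_
  rw [algebraMap_eq, totalDegree_C, zero_add]
  refine (totalDegree_finsetProd _ _).trans ((Finset.sum_le_sum fun i _ => ?_).trans (hc a ha))
  refine (totalDegree_pow _ _).trans ?_
  rw [mul_comm]
  exact Nat.mul_le_mul_right _ (hd i)

theorem finite_setOf_weight_le [Fintype ι] (d : ι → ℕ) (hd : ∀ i, 0 < d i) (D : ℕ) :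
    {a : ι →₀ ℕ | ∑ i, d i * a i ≤ D}.Finite := by
  refine ((Set.Finite.pi' fun _ : ι => Set.finite_le_nat D).preimage
    (f := fun a : ι →₀ ℕ => (a : ι → ℕ)) DFunLike.coe_injective.injOn).subset fun a ha i => ?_
  calc a i ≤ d i * a i := Nat.le_mul_of_pos_left _ (hd i)
    _ ≤ ∑ i, d i * a i :=
      Finset.single_le_sum (f := fun i => d i * a i) (fun _ _ => Nat.zero_le _) (Finset.mem_univ i)
    _ ≤ D := ha

theorem finite_setOf_degree_le [Fintype ι] (D : ℕ) :
    {a : ι →₀ ℕ | ∑ i, a i ≤ D}.Finite := by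
  simpa using finite_setOf_weight_le (fun _ : ι => 1) (fun _ => one_pos) D

/-- Division with remainder of the exponents compares the number of monomials of degree at most `D`
with the number of those of weighted degree at most `D`. -/
theorem card_degree_le_le_mul [Fintype ι] (d : ι → ℕ) (hd : ∀ i, 0 < d i) (D : ℕ) :
    {a : ι →₀ ℕ | ∑ i, a i ≤ D}.ncard ≤
      (∏ i, d i) * {a : ι →₀ ℕ | ∑ i, d i * a i ≤ D}.ncard := by
  classical
  have : Finite {a : ι →₀ ℕ | ∑ i, d i * a i ≤ D} := (finite_setOf_weight_le d hd D).to_subtype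
  let g : {a : ι →₀ ℕ | ∑ i, a i ≤ D} →
      (∀ i, Fin (d i)) × {a : ι →₀ ℕ | ∑ i, d i * a i ≤ D} := fun a =>
    (fun i => ⟨a.1 i % d i, Nat.mod_lt _ (hd i)⟩,
      ⟨Finsupp.equivFunOnFinite.symm fun i => a.1 i / d i, by
        refine le_trans (Finset.sum_le_sum fun i _ => ?_) (Set.mem_ofPred.1 a.2)
        simpa using Nat.mul_div_le (a.1 i) (d i)⟩)
  have hg : Function.Injective g := by
    intro a b hab
    ext i
    have h1 := congrArg (fun t => (t.1 i).1) hab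
    have h2 := congrArg (fun t => t.2.1 i) hab
    simp only [g, Finsupp.equivFunOnFinite_symm_apply_apply] at h1 h2
    rw [← Nat.div_add_mod (a.1 i) (d i), ← Nat.div_add_mod (b.1 i) (d i), h1, h2]
  have := Nat.card_le_card_of_injective g hg
  rwa [Nat.card_prod, Nat.card_pi, Nat.card_coe_set_eq, Nat.card_coe_set_eq,
    Finset.prod_congr rfl fun i _ => Nat.card_fin (d i)] at this

theorem card_degree_le_le_pow [Fintype ι] (D : ℕ) :
    {a : ι →₀ ℕ | ∑ i, a i ≤ D}.ncard ≤ (D + 1) ^ Fintype.card ι := by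
  classical
  let g : {a : ι →₀ ℕ | ∑ i, a i ≤ D} → (ι → Fin (D + 1)) := fun a i =>
    ⟨a.1 i, Nat.lt_succ_of_le (le_trans (by
      simpa using Finset.single_le_sum (f := fun i => a.1 i) (fun _ _ => Nat.zero_le _)
        (Finset.mem_univ i)) a.2)⟩
  have hg : Function.Injective g := fun a b hab => by
    ext i
    exact congrArg (fun t => (t i).1) hab
  have := Nat.card_le_card_of_injective g hg
  rw [Nat.card_coe_set_eq] at this
  simpa using this

/-- A polynomially bounded sequence does not grow by a factor `(P + 1) / P` in steps of bounded
length. -/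
theorem not_geometric_growth (T : ℕ → ℕ) (N c P : ℕ) (hP : 0 < P) (h0 : 0 < T 0)
    (hT : ∀ D, T D ≤ (D + 1) ^ N) : ¬ ∀ D, (P + 1) * T D ≤ P * T (D + c) := by
  intro h
  have h1 : ∀ r, (P + 1) ^ r ≤ P ^ r * T (c * r) := by
    intro r
    induction r with
    | zero => simpa using Nat.succ_le_of_lt h0
    | succ r ih =>
      calc (P + 1) ^ (r + 1) = (P + 1) * (P + 1) ^ r := by ring
        _ ≤ (P + 1) * (P ^ r * T (c * r)) := Nat.mul_le_mul_left _ ih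
        _ = P ^ r * ((P + 1) * T (c * r)) := by ring
        _ ≤ P ^ r * (P * T (c * r + c)) := Nat.mul_le_mul_left _ (h _)
        _ = P ^ (r + 1) * T (c * (r + 1)) := by rw [Nat.mul_succ]; ring
  have hPr : (0 : ℝ) < P := by exact_mod_cast hP
  have hq : 1 < ((P : ℝ) + 1) / P := by rw [one_lt_div hPr]; linarith
  have hlim := (tendsto_pow_const_div_const_pow_of_one_lt N hq).const_mul (((c : ℝ) + 1) ^ N)
  rw [mul_zero] at hlim
  obtain ⟨r, hr, hr1⟩ :=
    ((hlim.eventually_lt_const one_pos).and (Filter.eventually_ge_atTop 1)).exists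
  have h2 : ((P : ℝ) + 1) ^ r ≤ P ^ r * (((c : ℝ) + 1) * r) ^ N := by
    have h3 : (P + 1) ^ r ≤ P ^ r * ((c + 1) * r) ^ N :=
      (h1 r).trans (Nat.mul_le_mul_left _ ((hT _).trans (Nat.pow_le_pow_left (by
        rw [Nat.add_mul]; omega) _)))
    exact_mod_cast h3
  have h4 : (0 : ℝ) < P ^ r := by positivity
  have h5 : (0 : ℝ) < ((P : ℝ) + 1) ^ r := by positivity
  rw [div_pow, div_div_eq_mul_div, ← mul_div_assoc, div_lt_one h5] at hr
  rw [mul_pow] at h2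
  nlinarith

/-- **Bézout's bound** for the nondegenerate real zeros of a square polynomial system: there are at
most as many as the product of the degrees. -/
theorem card_nondegenerate_zeros_le [Fintype ι] (f : ι → MvPolynomial ι ℝ) (d : ι → ℕ)
    (hd0 : ∀ i, 0 < d i) (hd : ∀ i, (f i).totalDegree ≤ d i)
    (Z : Finset (ι → ℝ)) (hz : ∀ z ∈ Z, ∀ i, eval z (f i) = 0)
    (hnd : ∀ z ∈ Z, ∀ u, (∀ i, fderiv ℝ (fun x => eval x (f i)) z u = 0) → u = 0) :
    Z.card ≤ ∏ i, d i := by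
  classical
  choose p hp1 hp0 using fun z : Z => exists_eval_eq_ite Z z.1
  set c := Finset.univ.sup fun z : Z => (p z).totalDegree with hc
  set T : ℕ → ℕ := fun D => {a : ι →₀ ℕ | ∑ i, a i ≤ D}.ncard with hT
  set S : ℕ → Set (ι →₀ ℕ) := fun D => {a : ι →₀ ℕ | ∑ i, d i * a i ≤ D} with hS
  -- The map that sends coefficients of weighted degree at most `D` to the corresponding combination
  -- of the `p z` is injective, with values in the polynomials of degree at most `D + c`.
  have hdim : ∀ D, Z.card * (S D).ncard ≤ T (D + c) := by
    intro D
    have hfin1 : Finite {a : ι →₀ ℕ | ∑ i, a i ≤ D + c} :=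
      (finite_setOf_degree_le _).to_subtype
    have hfin2 : Finite (S D) := (finite_setOf_weight_le d hd0 D).to_subtype
    have := Module.Finite.of_basis (basisRestrictSupport ℝ {a : ι →₀ ℕ | ∑ i, a i ≤ D + c})
    have := Module.Finite.of_basis (basisRestrictSupport ℝ (S D))
    have r1 := Module.finrank_eq_nat_card_basis
      (basisRestrictSupport ℝ {a : ι →₀ ℕ | ∑ i, a i ≤ D + c})
    have r2 := Module.finrank_eq_nat_card_basis (basisRestrictSupport ℝ (S D))
    let Λ : (Z → restrictSupport ℝ (S D)) →ₗ[ℝ] MvPolynomial ι ℝ :=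
      ∑ z : Z, (LinearMap.mulRight ℝ (p z)) ∘ₗ (aeval f).toLinearMap ∘ₗ
        (restrictSupport ℝ (S D)).subtype ∘ₗ LinearMap.proj z
    have hΛ : ∀ u, Λ u = ∑ z : Z, aeval f (u z).1 * p z := by
      intro u
      simp [Λ]
    have hmem : ∀ u, Λ u ∈ restrictSupport ℝ {a : ι →₀ ℕ | ∑ i, a i ≤ D + c} := by
      intro u
      have h1 : (Λ u).totalDegree ≤ D + c := by
        rw [hΛ]
        refine totalDegree_finsetSum_le fun z _ => (totalDegree_mul _ _).trans ?_
        refine add_le_add (totalDegree_aeval_le f d hd D _ fun a ha => (u z).2 ha) ?_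
        exact Finset.le_sup (f := fun z : Z => (p z).totalDegree) (Finset.mem_univ z)
      rw [mem_restrictSupport_iff]
      intro a ha
      have := (le_totalDegree ha).trans h1
      rw [Finsupp.sum_fintype _ _ (fun _ => rfl)] at this
      simpa using this
    have hinj : Function.Injective (Λ.codRestrict _ hmem) := by
      rw [injective_iff_map_eq_zero]
      intro u hu
      have h0 : Λ u = 0 := congrArg Subtype.val hu
      rw [hΛ] at h0
      funext z
      exact Subtype.ext (eq_zero_of_sum_aeval_mul_eq_zero f Z hz hnd p hp1
        (fun z w hwz => hp0 z w.1 w.2 fun h => hwz (Subtype.ext h)) (fun z => (u z).1) h0 z)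
    have := LinearMap.finrank_le_finrank_of_injective hinj
    rw [Module.finrank_pi_fintype, r1] at this
    simpa [r2, Nat.card_coe_set_eq, hT] using this
  have hP : 0 < ∏ i, d i := Finset.prod_pos fun i _ => hd0 i
  by_contra hlt
  push Not at hlt
  refine not_geometric_growth T (Fintype.card ι) c (∏ i, d i) hP ?_ card_degree_le_le_pow ?_
  · exact Set.ncard_pos (finite_setOf_degree_le _) |>.2 ⟨0, by simp⟩
  · intro D
    calc (∏ i, d i + 1) * T D ≤ Z.card * ((∏ i, d i) * (S D).ncard) :=
          Nat.mul_le_mul hlt (card_degree_le_le_mul d hd0 D)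
      _ = (∏ i, d i) * (Z.card * (S D).ncard) := by ring
      _ ≤ (∏ i, d i) * T (D + c) := Nat.mul_le_mul_left _ (hdim D)

end MvPolynomial

/-! ### The area formula with bounded multiplicity -/

open MeasureTheory in
/-- If countably many `C¹` maps together cover no point of `R` more than `M` times by
points where they are nondegenerate, and map these points to `R`, then the integrals of their
Jacobians sum to at most `M` times the measure of `R`. -/
theorem tsum_lintegral_abs_det_fderiv_le {E : Type*} [NormedAddCommGroup E] [NormedSpace ℝ E]
    [FiniteDimensional ℝ E] [MeasurableSpace E] [BorelSpace E] (μ : Measure E)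
    [μ.IsAddHaarMeasure] {U : ℕ → Set E} (hU : ∀ j, IsOpen (U j)) {ψ : ℕ → E → E}
    (hψ : ∀ j, ContDiffOn ℝ 1 (ψ j) (U j)) (R : Set E)
    (hR : ∀ j, ∀ x ∈ U j, (fderiv ℝ (ψ j) x).det ≠ 0 → ψ j x ∈ R) (M : ℕ)
    (hM : ∀ y, ∀ T : Finset (ℕ × E), (∀ p ∈ T, p.2 ∈ U p.1 ∧ (fderiv ℝ (ψ p.1) p.2).det ≠ 0 ∧
      ψ p.1 p.2 = y) → T.card ≤ M) :
    ∑' j, ∫⁻ x in U j, ENNReal.ofReal |(fderiv ℝ (ψ j) x).det| ∂μ ≤ M * μ R := by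
  classical
  set W : ℕ → Set E := fun j => {x ∈ U j | (fderiv ℝ (ψ j) x).det ≠ 0} with hW
  have hcont : ∀ j, ContinuousOn (fun x => (fderiv ℝ (ψ j) x).det) (U j) := fun j =>
    ContinuousLinearMap.continuous_det.comp_continuousOn
      ((hψ j).continuousOn_fderiv_of_isOpen (hU j) le_rfl)
  have hWo : ∀ j, IsOpen (W j) := fun j =>
    (hcont j).isOpen_inter_preimage (hU j) (isOpen_ne (x := (0 : ℝ)))
  have hder : ∀ j, ∀ x ∈ W j, HasFDerivWithinAt (ψ j) (fderiv ℝ (ψ j) x) (W j) x := by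
    intro j x hx
    have h1 : DifferentiableAt ℝ (ψ j) x :=
      ((hψ j).differentiableOn (by simp) x hx.1).differentiableAt ((hU j).mem_nhds hx.1)
    exact h1.hasFDerivAt.hasFDerivWithinAt
  -- A map that approximates an invertible linear map this well is injective.
  have hr : ∀ A : E →L[ℝ] E, ∃ r : NNReal, r ≠ 0 ∧ (A.det ≠ 0 → ∀ (f : E → E) (s : Set E),
      ApproximatesLinearOn f A s r → Set.InjOn f s) := by
    intro A
    by_cases hA : A.det ≠ 0
    · let e := A.toContinuousLinearEquivOfDetNeZero hA
      have he : (e : E →L[ℝ] E) = A :=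
        ContinuousLinearMap.coe_toContinuousLinearEquivOfDetNeZero A hA
      rcases subsingleton_or_nontrivial E with hE | hE
      · exact ⟨1, one_ne_zero, fun _ f s _ => Set.injOn_of_subsingleton _ _⟩
      · have hpos : 0 < ‖(e.symm : E →L[ℝ] E)‖₊⁻¹ := by
          rw [inv_pos]
          exact e.nnnorm_symm_pos
        refine ⟨‖(e.symm : E →L[ℝ] E)‖₊⁻¹ / 2, (half_pos hpos).ne', fun _ f s hf => ?_⟩
        rw [← he] at hf
        exact hf.injOn (Or.inr (NNReal.half_lt_self hpos.ne'))
    · exact ⟨1, one_ne_zero, fun h => absurd h hA⟩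
  choose r hr0 hrinj using hr
  choose t A htd htm htc hta htA using fun j =>
    exists_partition_approximatesLinearOn_of_hasFDerivWithinAt (ψ j) (W j)
      (fun x => fderiv ℝ (ψ j) x) (hder j) r hr0
  set B : ℕ → ℕ → Set E := fun j k => W j ∩ t j k with hB
  have hBm : ∀ j k, MeasurableSet (B j k) := fun j k => (hWo j).measurableSet.inter (htm j k)
  have hinj : ∀ j k, Set.InjOn (ψ j) (B j k) := by
    intro j k
    rcases (W j).eq_empty_or_nonempty with h | h
    · simp [hB, h]
    · obtain ⟨y, hy, hAy⟩ := htA j h k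
      exact hrinj _ (by rw [hAy]; exact hy.2) _ _ (hta j k)
  have hderB : ∀ j k, ∀ x ∈ B j k, HasFDerivWithinAt (ψ j) (fderiv ℝ (ψ j) x) (B j k) x :=
    fun j k x hx => (hder j x hx.1).mono Set.inter_subset_left
  have hpiece : ∀ j, ∫⁻ x in U j, ENNReal.ofReal |(fderiv ℝ (ψ j) x).det| ∂μ
      = ∑' k, μ (ψ j '' B j k) := by
    intro j
    have h1 : ∫⁻ x in U j, ENNReal.ofReal |(fderiv ℝ (ψ j) x).det| ∂μ
        = ∫⁻ x in W j, ENNReal.ofReal |(fderiv ℝ (ψ j) x).det| ∂μ := by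
      rw [← lintegral_indicator (hU j).measurableSet, ← lintegral_indicator (hWo j).measurableSet]
      refine lintegral_congr fun x => ?_
      by_cases hx : x ∈ U j
      · by_cases hd : (fderiv ℝ (ψ j) x).det = 0
        · simp [Set.indicator, hd]
        · rw [Set.indicator_of_mem hx, Set.indicator_of_mem (show x ∈ W j from ⟨hx, hd⟩)]
      · rw [Set.indicator_of_notMem hx, Set.indicator_of_notMem fun h => hx h.1]
    have h2 : W j = ⋃ k, B j k := by
      rw [← Set.inter_iUnion]
      exact (Set.inter_eq_left.2 (htc j)).symm
    rw [h1]
    conv_lhs => rw [h2]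
    rw [lintegral_iUnion (hBm j) (fun k l hkl =>
      (htd j hkl).mono Set.inter_subset_right Set.inter_subset_right)]
    exact tsum_congr fun k =>
      lintegral_abs_det_fderiv_eq_addHaar_image μ (hBm j k) (hderB j k) (hinj j k)
  have him : ∀ j k, MeasurableSet (ψ j '' B j k) := fun j k =>
    measurable_image_of_fderivWithin (hBm j k) (hderB j k) (hinj j k)
  -- Each piece over `y` contains a different point over `y`.
  have hcount : ∀ y, ∑' q : ℕ × ℕ, (ψ q.1 '' B q.1 q.2).indicator (fun _ => (1 : ℝ≥0∞)) y
      ≤ R.indicator (fun _ => (M : ℝ≥0∞)) y := by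
    intro y
    rw [ENNReal.tsum_eq_iSup_sum]
    refine iSup_le fun s => ?_
    have hs : ∑ q ∈ s, (ψ q.1 '' B q.1 q.2).indicator (fun _ => (1 : ℝ≥0∞)) y
        = ((s.filter fun q => y ∈ ψ q.1 '' B q.1 q.2).card : ℝ≥0∞) := by
      simp [Set.indicator_apply]
    rw [hs]
    set s' := s.filter fun q => y ∈ ψ q.1 '' B q.1 q.2 with hs'
    have hex : ∀ q : ℕ × ℕ, ∃ x, q ∈ s' → x ∈ B q.1 q.2 ∧ ψ q.1 x = y := by
      intro q
      by_cases hq : q ∈ s'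
      · obtain ⟨x, hx⟩ := (Finset.mem_filter.1 hq).2
        exact ⟨x, fun _ => hx⟩
      · exact ⟨0, fun h => absurd h hq⟩
    choose x hx using hex
    have hcard : (s'.image fun q => (q.1, x q)).card = s'.card := by
      refine Finset.card_image_of_injOn ?_
      intro q hq q' hq' h
      obtain ⟨h1, h2⟩ := Prod.mk.inj h
      refine Prod.ext h1 ?_
      by_contra hne
      have e1 := (hx q hq).1.2
      have e2 := (hx q' hq').1.2
      rw [← h2, ← h1] at e2
      exact Set.disjoint_left.1 (htd q.1 hne) e1 e2
    have hle : s'.card ≤ M := by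
      rw [← hcard]
      refine hM y _ fun p hp => ?_
      obtain ⟨q, hq, rfl⟩ := Finset.mem_image.1 hp
      exact ⟨(hx q hq).1.1.1, (hx q hq).1.1.2, (hx q hq).2⟩
    by_cases hy : y ∈ R
    · rw [Set.indicator_of_mem hy]
      exact_mod_cast hle
    · rw [Set.indicator_of_notMem hy]
      have : s' = ∅ := by
        refine Finset.eq_empty_of_forall_notMem fun q hq => hy ?_
        rw [← (hx q hq).2]
        exact hR _ _ (hx q hq).1.1.1 (hx q hq).1.1.2
      simp [this]
  calc ∑' j, ∫⁻ x in U j, ENNReal.ofReal |(fderiv ℝ (ψ j) x).det| ∂μ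
      = ∑' j, ∑' k, μ (ψ j '' B j k) := tsum_congr hpiece
    _ = ∑' q : ℕ × ℕ, μ (ψ q.1 '' B q.1 q.2) :=
        (ENNReal.tsum_prod (f := fun j k => μ (ψ j '' B j k))).symm
    _ = ∑' q : ℕ × ℕ, ∫⁻ y, (ψ q.1 '' B q.1 q.2).indicator (fun _ => (1 : ℝ≥0∞)) y ∂μ := by
        refine tsum_congr fun q => ?_
        rw [lintegral_indicator (him _ _)]
        simp
    _ = ∫⁻ y, ∑' q : ℕ × ℕ, (ψ q.1 '' B q.1 q.2).indicator (fun _ => (1 : ℝ≥0∞)) y ∂μ :=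
        (lintegral_tsum fun q => (measurable_const.indicator (him _ _)).aemeasurable).symm
    _ ≤ ∫⁻ y, R.indicator (fun _ => (M : ℝ≥0∞)) y ∂μ := lintegral_mono hcount
    _ ≤ M * μ R := lintegral_indicator_const_le _ _

/-! ### The exterior powers of a sum of decomposable two-forms -/

/-- The identification of `m` pairs with `2 m` indices that underlies `wedgePow`: the members
`(j, false)` and `(j, true)` of the `j`-th pair go to `2 j` and `2 j + 1`. -/
def pairEquiv (m : ℕ) : Fin m × Bool ≃ Fin (2 * m) where
  toFun q := if q.2 then ⟨2 * q.1 + 1, by omega⟩ else ⟨2 * q.1, by omega⟩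
  invFun r := (⟨r / 2, by omega⟩, decide (r.1 % 2 = 1))
  left_inv := by
    rintro ⟨j, _ | _⟩
    · ext <;> simp
    · ext
      · simp
        omega
      · simp
  right_inv := by
    intro r
    ext
    rcases Nat.mod_two_eq_zero_or_one r with h | h <;> simp [h] <;> omega

/-- The permutation of the `2 m` indices that exchanges the members of the pairs `j` with `b j`. -/
def pairSwap {m : ℕ} (b : Fin m → Bool) : Equiv.Perm (Fin (2 * m)) :=
  (pairEquiv m).permCongr
    (Equiv.prodCongrRight fun j => if b j then Equiv.swap false true else 1)

theorem sign_pairSwap {m : ℕ} (b : Fin m → Bool) :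
    Equiv.Perm.sign (pairSwap b) = ∏ j, if b j then -1 else 1 := by
  rw [pairSwap, Equiv.Perm.sign_permCongr, Equiv.Perm.sign_prodCongrRight]
  refine Finset.prod_congr rfl fun j _ => ?_
  split_ifs <;> simp

theorem pairSwap_pairEquiv {m : ℕ} (b : Fin m → Bool) (j : Fin m) (c : Bool) :
    pairSwap b (pairEquiv m (j, c)) = pairEquiv m (j, xor (b j) c) := by
  rw [pairSwap, Equiv.permCongr_apply, Equiv.symm_apply_apply, Equiv.prodCongrRight_apply]
  cases b j <;> cases c <;> simp

/-- The alternating sum over permutations of a product of `2 × 2` minors is `2 ^ m` times the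
full determinant. -/
theorem sum_sign_prod_minors {m : ℕ} (p q : Fin m → Fin (2 * m) → ℝ) :
    ∑ s : Equiv.Perm (Fin (2 * m)), ((Equiv.Perm.sign s : ℤ) : ℝ) * ∏ j : Fin m,
      (p j (s (pairEquiv m (j, false))) * q j (s (pairEquiv m (j, true)))
        - p j (s (pairEquiv m (j, true))) * q j (s (pairEquiv m (j, false))))
      = 2 ^ m * Matrix.det (Matrix.of fun r k : Fin (2 * m) =>
          (bif ((pairEquiv m).symm r).2 then q else p) ((pairEquiv m).symm r).1 k) := by
  have hexp : ∀ s : Equiv.Perm (Fin (2 * m)), ∏ j : Fin m,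
      (p j (s (pairEquiv m (j, false))) * q j (s (pairEquiv m (j, true)))
        - p j (s (pairEquiv m (j, true))) * q j (s (pairEquiv m (j, false))))
      = ∑ b : Fin m → Bool, ((Equiv.Perm.sign (pairSwap b) : ℤ) : ℝ) * ∏ j,
        (p j ((s * pairSwap b) (pairEquiv m (j, false)))
          * q j ((s * pairSwap b) (pairEquiv m (j, true)))) := by
    intro s
    have h1 : ∀ j : Fin m, (p j (s (pairEquiv m (j, false))) * q j (s (pairEquiv m (j, true)))
        - p j (s (pairEquiv m (j, true))) * q j (s (pairEquiv m (j, false))))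
        = ∑ b : Bool, (if b then (-1 : ℝ) else 1) * (p j (s (pairEquiv m (j, xor b false)))
          * q j (s (pairEquiv m (j, xor b true)))) := by
      intro j
      simp
      ring
    rw [Finset.prod_congr rfl fun j _ => h1 j, Finset.prod_univ_sum, Fintype.piFinset_univ]
    refine Finset.sum_congr rfl fun b _ => ?_
    rw [Finset.prod_mul_distrib, sign_pairSwap]
    congr 1
    · push_cast
      refine Finset.prod_congr rfl fun j _ => ?_
      split_ifs <;> simp
    · simp only [Equiv.Perm.mul_apply, pairSwap_pairEquiv]
  simp only [hexp, Finset.mul_sum]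
  rw [Finset.sum_comm]
  have hdet : ∀ b : Fin m → Bool, ∑ s : Equiv.Perm (Fin (2 * m)),
      ((Equiv.Perm.sign s : ℤ) : ℝ) * (((Equiv.Perm.sign (pairSwap b) : ℤ) : ℝ) * ∏ j,
        (p j ((s * pairSwap b) (pairEquiv m (j, false)))
          * q j ((s * pairSwap b) (pairEquiv m (j, true)))))
      = Matrix.det (Matrix.of fun r k : Fin (2 * m) =>
          (bif ((pairEquiv m).symm r).2 then q else p) ((pairEquiv m).symm r).1 k) := by
    intro b
    rw [← Matrix.det_transpose, Matrix.det_apply']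
    refine Fintype.sum_equiv (Equiv.mulRight (pairSwap b)) _ _ fun s => ?_
    rw [Equiv.coe_mulRight, Equiv.Perm.sign_mul, ← mul_assoc]
    congr 1
    · push_cast
      rfl
    · rw [← (pairEquiv m).prod_comp, Fintype.prod_prod_type]
      refine Finset.prod_congr rfl fun j _ => ?_
      rw [Fintype.prod_bool, mul_comm]
      simp
  rw [Finset.sum_congr rfl fun b _ => hdet b]
  simp

/-- The `m`-fold exterior power of `c ∑ᵢ Pᵢ ∧ Qᵢ`, as a sum over the choices of `m` summands. -/
theorem wedgePow_sum_decomposable {E ι : Type*} [Fintype ι] (c : ℝ) (P Q : ι → E → ℝ) (m : ℕ)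
    (v : Fin (2 * m) → E) :
    wedgePow (fun u w => c * ∑ i, (P i u * Q i w - P i w * Q i u)) m v =
      c ^ m * ∑ f : Fin m → ι, Matrix.det (Matrix.of fun r k : Fin (2 * m) =>
        (bif ((pairEquiv m).symm r).2 then Q else P) (f ((pairEquiv m).symm r).1) (v k)) := by
  classical
  have h1 : ∀ s : Equiv.Perm (Fin (2 * m)), ∏ j : Fin m, c * ∑ i,
      (P i (v (s ⟨2 * j, by omega⟩)) * Q i (v (s ⟨2 * j + 1, by omega⟩))
        - P i (v (s ⟨2 * j + 1, by omega⟩)) * Q i (v (s ⟨2 * j, by omega⟩)))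
      = c ^ m * ∑ f : Fin m → ι, ∏ j : Fin m,
        (P (f j) (v (s (pairEquiv m (j, false)))) * Q (f j) (v (s (pairEquiv m (j, true))))
        - P (f j) (v (s (pairEquiv m (j, true)))) * Q (f j) (v (s (pairEquiv m (j, false))))) := by
    intro s
    rw [Finset.prod_mul_distrib, Finset.prod_univ_sum, Fintype.piFinset_univ]
    simp [pairEquiv]
  simp only [wedgePow, h1]
  have h2 : ∀ s : Equiv.Perm (Fin (2 * m)), ∀ t : ℝ, ((Equiv.Perm.sign s : ℤ) : ℝ) * (c ^ m * t)
      = c ^ m * (((Equiv.Perm.sign s : ℤ) : ℝ) * t) := fun s t => by ring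
  simp only [h2, ← Finset.mul_sum]
  rw [mul_left_comm]
  congr 1
  simp only [Finset.mul_sum]
  rw [Finset.sum_comm]
  refine Finset.sum_congr rfl fun f _ => ?_
  rw [← Finset.mul_sum, sum_sign_prod_minors (fun j k => P (f j) (v k)) (fun j k => Q (f j) (v k)),
    ← mul_assoc, one_div, inv_mul_cancel₀ (by positivity), one_mul]
  congr 2
  ext r k
  cases ((pairEquiv m).symm r).2 <;> rfl

/-- A choice of `m` decomposable summands that repeats one of them contributes nothing. -/
theorem det_pairRows_eq_zero {m : ℕ} {ι : Type*} (p q : ι → Fin (2 * m) → ℝ) (f : Fin m → ι)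
    (hf : ¬ Function.Injective f) :
    Matrix.det (Matrix.of fun r k : Fin (2 * m) =>
      (bif ((pairEquiv m).symm r).2 then q else p) (f ((pairEquiv m).symm r).1) k) = 0 := by
  simp only [Function.Injective, not_forall] at hf
  obtain ⟨i, j, hij, hne⟩ := hf
  refine Matrix.det_zero_of_row_eq (i := pairEquiv m (i, false)) (j := pairEquiv m (j, false)) ?_ ?_
  · intro h
    exact hne (congrArg Prod.fst ((pairEquiv m).injective h))
  · ext k
    simp [hij]

/-! ### The area of the space of triangle shapes -/

/-- The shapes of Euclidean triangles: the pairs `(p, q)` for which there is a nondegenerate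
triangle with sides `exp p`, `exp q` and `1`. -/
def triangleShapes : Set (ℝ × ℝ) :=
  {y | 1 < Real.exp y.1 + Real.exp y.2 ∧ Real.exp y.2 < Real.exp y.1 + 1 ∧
    Real.exp y.1 < Real.exp y.2 + 1}

theorem isOpen_triangleShapes : IsOpen triangleShapes := by
  have h1 : IsOpen {y : ℝ × ℝ | 1 < Real.exp y.1 + Real.exp y.2} :=
    isOpen_lt (by fun_prop) (by fun_prop)
  have h2 : IsOpen {y : ℝ × ℝ | Real.exp y.2 < Real.exp y.1 + 1} :=
    isOpen_lt (by fun_prop) (by fun_prop)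
  have h3 : IsOpen {y : ℝ × ℝ | Real.exp y.1 < Real.exp y.2 + 1} :=
    isOpen_lt (by fun_prop) (by fun_prop)
  exact h1.inter (h2.inter h3)

open Real in
/-- A slice of the space of triangle shapes is an interval, of length given by the series of the
inverse hyperbolic tangent. -/
theorem volume_triangleShapes_slice {p : ℝ} (hp : p ≠ 0) :
    MeasureTheory.volume (Prod.mk p ⁻¹' triangleShapes) =
      ∑' k : ℕ, ENNReal.ofReal (2 / (2 * k + 1) * exp (-(2 * k + 1) * |p|)) := by
  have hne : 1 - exp p ≠ 0 := by
    intro h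
    exact hp (exp_eq_one_iff p |>.1 (by linarith))
  have habs : 0 < |1 - exp p| := abs_pos.2 hne
  have hpos : 0 < 1 + exp p := by positivity
  have hset : Prod.mk p ⁻¹' triangleShapes
      = Set.Ioo (log |1 - exp p|) (log (1 + exp p)) := by
    ext q
    rw [Set.mem_Ioo, log_lt_iff_lt_exp habs, lt_log_iff_exp_lt hpos, abs_lt]
    simp only [triangleShapes, Set.mem_preimage, Set.mem_ofPred_eq]
    constructor
    · rintro ⟨h1, h2, h3⟩
      exact ⟨⟨by linarith, by linarith⟩, by linarith⟩
    · rintro ⟨⟨h1, h2⟩, h3⟩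
      exact ⟨by linarith, by linarith, by linarith⟩
  have hx1 : exp (-|p|) < 1 := by
    rw [exp_lt_one_iff]
    simpa using hp
  have hx0 : 0 < exp (-|p|) := exp_pos _
  -- The length is an even function of `p`.
  have hlen : log (1 + exp p) - log |1 - exp p|
      = log (1 + exp (-|p|)) - log (1 - exp (-|p|)) := by
    rcases lt_or_gt_of_ne hp with h | h
    · rw [abs_of_neg h, neg_neg, abs_of_pos]
      have := exp_lt_one_iff.2 h
      linarith
    · rw [abs_of_pos h]
      have h1 : 1 < exp p := one_lt_exp_iff.2 h
      rw [abs_of_neg (by linarith), ← log_div hpos.ne' (by linarith), ← log_div (by positivity)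
        (by rw [abs_of_pos h] at hx1; linarith)]
      congr 1
      rw [exp_neg]
      have h2 : exp p - 1 ≠ 0 := by linarith
      field_simp
      ring
  have hsum := hasSum_log_sub_log_of_abs_lt_one (x := exp (-|p|)) (by rwa [abs_of_pos hx0])
  rw [hset, Real.volume_Ioo, hlen, ← hsum.tsum_eq, ENNReal.ofReal_tsum_of_nonneg _ hsum.summable]
  · refine tsum_congr fun k => ?_
    rw [← exp_nat_mul]
    congr 1
    push_cast
    ring_nf
  · intro k
    positivity

open MeasureTheory Real in
theorem lintegral_exp_neg_mul_abs {a : ℝ} (ha : 0 < a) :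
    ∫⁻ p : ℝ, ENNReal.ofReal (exp (-a * |p|)) = ENNReal.ofReal (2 / a) := by
  have hIoi : ∫⁻ p in Set.Ioi (0 : ℝ), ENNReal.ofReal (exp (-a * |p|))
      = ENNReal.ofReal (1 / a) := by
    have h1 : ∫⁻ p in Set.Ioi (0 : ℝ), ENNReal.ofReal (exp (-a * |p|))
        = ∫⁻ p in Set.Ioi (0 : ℝ), ENNReal.ofReal (exp (-a * p)) :=
      setLIntegral_congr_fun measurableSet_Ioi fun p hp => by rw [abs_of_pos hp]
    rw [h1, ← ofReal_integral_eq_lintegral_ofReal (integrableOn_exp_mul_Ioi (by linarith) 0)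
      (Filter.Eventually.of_forall fun p => (exp_pos _).le), integral_exp_mul_Ioi (by linarith) 0]
    congr 1
    simp
  have hIio : ∫⁻ p in Set.Iio (0 : ℝ), ENNReal.ofReal (exp (-a * |p|))
      = ENNReal.ofReal (1 / a) := by
    rw [← hIoi, ← (Measure.measurePreserving_neg
      (volume : Measure ℝ)).setLIntegral_comp_preimage_emb (MeasurableEquiv.neg ℝ).measurableEmbedding]
    simp
  rw [← lintegral_add_compl _ (measurableSet_Iio (a := (0 : ℝ))), hIio, Set.compl_Iio,
    setLIntegral_congr Ioi_ae_eq_Ici.symm, hIoi,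
    ← ENNReal.ofReal_add (by positivity) (by positivity)]
  congr 1
  ring

open MeasureTheory Real in
theorem volume_triangleShapes_le : volume triangleShapes ≤ 5 := by
  have h1 : volume triangleShapes = ∑' k : ℕ, ENNReal.ofReal (4 / (2 * k + 1) ^ 2) := by
    rw [Measure.volume_eq_prod, Measure.prod_apply isOpen_triangleShapes.measurableSet]
    have hae : ∀ᵐ p : ℝ, volume (Prod.mk p ⁻¹' triangleShapes) =
        ∑' k : ℕ, ENNReal.ofReal (2 / (2 * k + 1) * exp (-(2 * k + 1) * |p|)) := by
      filter_upwards [Measure.ae_ne volume (0 : ℝ)] with p hp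
      exact volume_triangleShapes_slice hp
    rw [lintegral_congr_ae hae, lintegral_tsum fun k => by fun_prop]
    refine tsum_congr fun k => ?_
    have hk : (0 : ℝ) < 2 * k + 1 := by positivity
    simp_rw [ENNReal.ofReal_mul (show (0 : ℝ) ≤ 2 / (2 * k + 1) by positivity)]
    rw [lintegral_const_mul _ (by fun_prop), lintegral_exp_neg_mul_abs hk,
      ← ENNReal.ofReal_mul (by positivity)]
    congr 1
    field_simp
    norm_num
  rw [h1]
  refine ENNReal.tsum_le_of_sum_range_le fun n => ?_
  rw [← ENNReal.ofReal_sum_of_nonneg (fun k _ => by positivity)]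
  -- The partial sums are compared with the telescoping sums of `1 / k - 1 / (k + 1)`.
  have htel : ∀ n : ℕ, ∑ k ∈ Finset.range (n + 1), (4 : ℝ) / (2 * k + 1) ^ 2
      ≤ 5 - 1 / ((n : ℝ) + 1) := by
    intro n
    induction n with
    | zero => norm_num
    | succ n ih =>
      rw [Finset.sum_range_succ]
      have hn : (0 : ℝ) < n + 1 := by positivity
      have h2 : (4 : ℝ) / (2 * ((n + 1 : ℕ) : ℝ) + 1) ^ 2
          ≤ 1 / ((n : ℝ) + 1) - 1 / (((n + 1 : ℕ) : ℝ) + 1) := by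
        push_cast
        rw [div_sub_div _ _ hn.ne' (by positivity), div_le_div_iff₀ (by positivity) (by positivity)]
        nlinarith
      linarith
  have h3 : ∑ k ∈ Finset.range n, (4 : ℝ) / (2 * k + 1) ^ 2 ≤ 5 := by
    refine le_trans (Finset.sum_le_sum_of_subset_of_nonneg (Finset.range_mono n.le_succ)
      fun k _ _ => by positivity) ((htel n).trans ?_)
    have : (0 : ℝ) ≤ 1 / ((n : ℝ) + 1) := by positivity
    linarith
  calc ENNReal.ofReal (∑ k ∈ Finset.range n, (4 : ℝ) / (2 * k + 1) ^ 2) ≤ ENNReal.ofReal 5 :=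
        ENNReal.ofReal_le_ofReal h3
    _ = 5 := by simp

open MeasureTheory in
theorem volume_setOf_pairs_mem (m : ℕ) (R : Set (ℝ × ℝ)) (hR : MeasurableSet R) :
    volume {y : Fin (2 * m) → ℝ | ∀ j, (y (pairEquiv m (j, false)), y (pairEquiv m (j, true))) ∈ R}
      = volume R ^ m := by
  let σ : Fin m ⊕ Fin m ≃ Fin (2 * m) :=
    (Equiv.boolProdEquivSum (Fin m)).symm.trans ((Equiv.prodComm _ _).trans (pairEquiv m))
  have h1 := (volume_measurePreserving_piCongrLeft (fun _ : Fin (2 * m) => ℝ) σ).symm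
  have h2 := volume_measurePreserving_sumPiEquivProdPi (fun _ : Fin m ⊕ Fin m => ℝ)
  have h3 := (volume_measurePreserving_arrowProdEquivProdArrow ℝ ℝ (Fin m)).symm
  have hG := h3.comp (h2.comp h1)
  have hset : {y : Fin (2 * m) → ℝ |
      ∀ j, (y (pairEquiv m (j, false)), y (pairEquiv m (j, true))) ∈ R}
      = ((MeasurableEquiv.arrowProdEquivProdArrow ℝ ℝ (Fin m)).symm ∘
          (MeasurableEquiv.sumPiEquivProdPi (fun _ : Fin m ⊕ Fin m => ℝ)) ∘
          (MeasurableEquiv.piCongrLeft (fun _ : Fin (2 * m) => ℝ) σ).symm) ⁻¹'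
        (Set.pi Set.univ fun _ : Fin m => R) := by
    ext y
    simp only [Set.mem_preimage, Set.mem_pi, Set.mem_univ, true_implies]
    rfl
  rw [hset, hG.measure_preimage (MeasurableSet.univ_pi fun _ => hR).nullMeasurableSet, volume_pi_pi]
  simp

/-! ### Vertices, edges and faces of a trivalent fatgraph -/

namespace TrivalentFatgraph

variable {H : Type*} (Γ : TrivalentFatgraph H)

/-- The vertex of a half-edge. -/
def vertex (h : H) : Γ.Vertex := Quotient.mk _ h

noncomputable instance [Fintype H] : Fintype Γ.Vertex :=
  haveI : Finite Γ.Vertex := Quotient.finite _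
  Fintype.ofFinite _

noncomputable instance [Fintype H] : Fintype Γ.Face :=
  haveI : Finite Γ.Face := Quotient.finite _
  Fintype.ofFinite _

theorem sameCycle_next_iff (h h' : H) :
    Γ.next.SameCycle h h' ↔ h' = h ∨ h' = Γ.next h ∨ h' = Γ.next (Γ.next h) := by
  constructor
  · rintro ⟨i, rfl⟩
    have h3 : Γ.next ^ (3 : ℤ) = 1 := by
      ext x
      exact Γ.next_next_next x
    have hi : Γ.next ^ i = Γ.next ^ (i % 3) := by
      conv_lhs => rw [← Int.mul_ediv_add_emod i 3, zpow_add, zpow_mul, h3, one_zpow, one_mul]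
    have : i % 3 = 0 ∨ i % 3 = 1 ∨ i % 3 = 2 := by omega
    rw [hi]
    rcases this with h | h | h
    · left; rw [h]; rfl
    · right; left; rw [h]; rfl
    · right; right; rw [h]; rfl
  · rintro (rfl | rfl | rfl)
    · exact Equiv.Perm.SameCycle.refl _ _
    · exact ⟨1, rfl⟩
    · exact ⟨2, rfl⟩

theorem sameCycle_flip_iff (h h' : H) : Γ.flip.SameCycle h h' ↔ h' = h ∨ h' = Γ.flip h := by
  constructor
  · rintro ⟨i, rfl⟩
    have h2 : Γ.flip ^ (2 : ℤ) = 1 := by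
      ext x
      exact Γ.flip_flip x
    have hi : Γ.flip ^ i = Γ.flip ^ (i % 2) := by
      conv_lhs => rw [← Int.mul_ediv_add_emod i 2, zpow_add, zpow_mul, h2, one_zpow, one_mul]
    rw [hi]
    rcases Int.emod_two_eq_zero_or_one i with h | h
    · left; rw [h]; rfl
    · right; rw [h]; rfl
  · rintro (rfl | rfl)
    · exact Equiv.Perm.SameCycle.refl _ _
    · exact ⟨1, rfl⟩

theorem next_next_ne (h : H) : Γ.next (Γ.next h) ≠ h := by
  intro e
  have := Γ.next_next_next h
  rw [e] at this
  exact Γ.next_ne h this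

theorem edge_eq_iff (h h' : H) : Γ.edge h' = Γ.edge h ↔ h' = h ∨ h' = Γ.flip h := by
  rw [← Γ.sameCycle_flip_iff h h']
  exact Quotient.eq.trans Equiv.Perm.sameCycle_comm

@[simp]
theorem edge_flip (h : H) : Γ.edge (Γ.flip h) = Γ.edge h := (Γ.edge_eq_iff _ _).2 (Or.inr rfl)

@[simp]
theorem face_next_flip (h : H) : Γ.face (Γ.next (Γ.flip h)) = Γ.face h :=
  Quotient.sound (Equiv.Perm.SameCycle.symm ⟨1, rfl⟩)

theorem face_flip (h : H) : Γ.face (Γ.flip h) = Γ.face (Γ.next h) := by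
  rw [← Γ.face_next_flip (Γ.flip h), Γ.flip_flip]

theorem edge_out (e : Γ.Edge) : Γ.edge (Quotient.out e) = e := Quotient.out_eq e

/-- The exponent by which `λ(e)` scales when the horocycle of each face `i` is moved by `s i`. -/
noncomputable def edgeWeight (s : Γ.Face → ℝ) (e : Γ.Edge) : ℝ :=
  s (Γ.face (Quotient.out e)) + s (Γ.face (Γ.flip (Quotient.out e)))

theorem edgeWeight_edge (s : Γ.Face → ℝ) (h : H) :
    Γ.edgeWeight s (Γ.edge h) = s (Γ.face h) + s (Γ.face (Γ.next h)) := by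
  rw [← Γ.face_flip]
  rcases (Γ.edge_eq_iff h _).1 (Γ.edge_out (Γ.edge h)) with h1 | h1
  · rw [edgeWeight, h1]
  · rw [edgeWeight, h1, Γ.flip_flip, add_comm]

variable [Fintype H]

theorem sum_eq_sum_vertex {M : Type*} [AddCommMonoid M] (F : H → M) :
    ∑ h, F h = ∑ v : Γ.Vertex, (F (Quotient.out v) + F (Γ.next (Quotient.out v))
      + F (Γ.next (Γ.next (Quotient.out v)))) := by
  classical
  rw [← Finset.sum_fiberwise Finset.univ Γ.vertex F]
  refine Finset.sum_congr rfl fun v _ => ?_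
  have hset : (Finset.univ.filter fun h : H => Γ.vertex h = v)
      = {Quotient.out v, Γ.next (Quotient.out v), Γ.next (Γ.next (Quotient.out v))} := by
    ext h
    simp only [Finset.mem_filter, Finset.mem_univ, true_and, Finset.mem_insert,
      Finset.mem_singleton]
    rw [← Γ.sameCycle_next_iff (Quotient.out v) h]
    conv_lhs => rw [← Quotient.out_eq v]
    exact Quotient.eq.trans Equiv.Perm.sameCycle_comm
  rw [hset, Finset.sum_insert, Finset.sum_insert, Finset.sum_singleton, add_assoc]
  · simpa using (Γ.next_ne _).symm
  · simp only [Finset.mem_insert, Finset.mem_singleton, not_or]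
    exact ⟨(Γ.next_ne _).symm, (Γ.next_next_ne _).symm⟩

theorem filter_edge_eq [DecidableEq H] [DecidableEq Γ.Edge] (h : H) :
    (Finset.univ.filter fun h' : H => Γ.edge h' = Γ.edge h) = {h, Γ.flip h} := by
  ext h'
  simp [Γ.edge_eq_iff h h']

theorem card_halfEdge_eq_three_mul : Fintype.card H = 3 * Fintype.card Γ.Vertex := by
  have := Γ.sum_eq_sum_vertex (fun _ => 1)
  simp only [Finset.sum_const, Finset.card_univ, smul_eq_mul] at this
  omega

theorem card_halfEdge_eq_two_mul : Fintype.card H = 2 * Fintype.card Γ.Edge := by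
  classical
  have h1 : Fintype.card H = ∑ e : Γ.Edge, (Finset.univ.filter fun h : H => Γ.edge h = e).card := by
    rw [← Finset.card_univ]
    exact Finset.card_eq_sum_card_fiberwise fun _ _ => Finset.mem_coe.2 (Finset.mem_univ _)
  have h2 : ∀ e : Γ.Edge, (Finset.univ.filter fun h : H => Γ.edge h = e).card = 2 := by
    intro e
    have := Γ.filter_edge_eq (Quotient.out e)
    rw [Γ.edge_out] at this
    rw [this, Finset.card_pair (Γ.flip_ne _).symm]
  rw [h1, Finset.sum_congr rfl fun e _ => h2 e]
  simp [mul_comm]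

/-! ### Horocyclic lengths of the corners -/

/-- The length of the horocyclic arc at the corner between `h` and the next half-edge at its vertex:
the `λ`-length of the opposite edge, divided by those of the two adjacent edges. -/
noncomputable def corner (lam : Γ.Edge → ℝ) (h : H) : ℝ :=
  lam (Γ.edge (Γ.next (Γ.next h))) / (lam (Γ.edge h) * lam (Γ.edge (Γ.next h)))

/-- The contribution to the simplicial coordinate of an edge of its end `h`: the two adjacent
corners minus the opposite one. -/
theorem simplicialCoord_edge (lam : Γ.Edge → ℝ) (h : H) :
    Γ.simplicialCoord lam (Γ.edge h) =
      (Γ.corner lam (Γ.next (Γ.next h)) + Γ.corner lam h - Γ.corner lam (Γ.next h)) +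
      (Γ.corner lam (Γ.next (Γ.next (Γ.flip h))) + Γ.corner lam (Γ.flip h)
        - Γ.corner lam (Γ.next (Γ.flip h))) := by
  classical
  have hset := Γ.filter_edge_eq h
  have h1 : ∀ k : H, Γ.edge k = Γ.edge h →
      lam (Γ.edge (Γ.next k)) / (lam (Γ.edge h) * lam (Γ.edge (Γ.next (Γ.next k))))
      + lam (Γ.edge (Γ.next (Γ.next k))) / (lam (Γ.edge h) * lam (Γ.edge (Γ.next k)))
      - lam (Γ.edge h) / (lam (Γ.edge (Γ.next k)) * lam (Γ.edge (Γ.next (Γ.next k))))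
      = Γ.corner lam (Γ.next (Γ.next k)) + Γ.corner lam k - Γ.corner lam (Γ.next k) := by
    intro k hk
    simp only [corner, Γ.next_next_next, hk]
    ring
  rw [simplicialCoord, Finset.sum_congr (by convert hset) fun k _ => rfl,
    Finset.sum_pair (Γ.flip_ne h).symm, h1 h rfl, h1 _ (Γ.edge_flip h)]

open Classical in
/-- Along a boundary path the simplicial coordinates add up to twice the length of the horocycle:
the corners opposite to the traversed ends cancel against the adjacent corners outside the face. -/
theorem rho_eq_sum_corner (lam : Γ.Edge → ℝ) (i : Γ.Face) :
    Γ.rho lam i = 2 * ∑ h : H with Γ.face h = i, Γ.corner lam (Γ.next (Γ.next h)) := by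
  set Y : H → ℝ := fun h =>
    Γ.corner lam (Γ.next (Γ.next h)) + Γ.corner lam h - Γ.corner lam (Γ.next h) with hY
  have h1 : ∑ h : H with Γ.face h = i, Y (Γ.flip h)
      = ∑ h : H with Γ.face h = i, Y (Γ.next (Γ.next h)) := by
    refine Finset.sum_equiv (Γ.flip.trans Γ.next) (fun h => ?_) fun h _ => ?_
    · simp
    · simp [Γ.next_next_next]
  calc Γ.rho lam i = ∑ h : H with Γ.face h = i, (Y h + Y (Γ.flip h)) :=
        Finset.sum_congr rfl fun h _ => Γ.simplicialCoord_edge lam h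
    _ = ∑ h : H with Γ.face h = i, (Y h + Y (Γ.next (Γ.next h))) := by
        rw [Finset.sum_add_distrib, h1, ← Finset.sum_add_distrib]
    _ = _ := by
        rw [Finset.mul_sum]
        refine Finset.sum_congr rfl fun h _ => ?_
        simp only [hY, Γ.next_next_next]
        ring

/-- Moving the horocycle of the face `i` by `s i` multiplies its length by `exp (-2 s i)`. -/
theorem rho_scale (lam : Γ.Edge → ℝ) (s : Γ.Face → ℝ) (i : Γ.Face) :
    Γ.rho (fun e => lam e * Real.exp (Γ.edgeWeight s e)) i = Real.exp (-2 * s i) * Γ.rho lam i := by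
  classical
  rw [rho_eq_sum_corner, rho_eq_sum_corner, mul_left_comm]
  congr 1
  rw [Finset.mul_sum]
  refine Finset.sum_congr rfl fun h hh => ?_
  obtain rfl : Γ.face h = i := (Finset.mem_filter.1 hh).2
  have h1 : Real.exp (-2 * s (Γ.face h)) * (Real.exp (Γ.edgeWeight s (Γ.edge (Γ.next (Γ.next h))))
      * Real.exp (Γ.edgeWeight s (Γ.edge h))) = Real.exp (Γ.edgeWeight s (Γ.edge (Γ.next h))) := by
    rw [← Real.exp_add, ← Real.exp_add]
    congr 1
    simp only [edgeWeight_edge, Γ.next_next_next]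
    ring
  simp only [corner, Γ.next_next_next]
  rw [← h1]
  have e1 := (Real.exp_pos (Γ.edgeWeight s (Γ.edge (Γ.next (Γ.next h))))).ne'
  have e2 := (Real.exp_pos (Γ.edgeWeight s (Γ.edge h))).ne'
  rw [show ∀ a b c x y z : ℝ, a * (x * (y * z)) / (b * y * (c * z))
    = x * (a / (b * c)) * ((y * z) / (y * z)) by intros; ring, div_self (mul_ne_zero e1 e2), mul_one]

theorem differentiableAt_rho {lam : Γ.Edge → ℝ} (hlam : ∀ e, 0 < lam e) :
    DifferentiableAt ℝ Γ.rho lam := by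
  classical
  rw [differentiableAt_pi]
  intro i
  have : (fun x : Γ.Edge → ℝ => Γ.rho x i) = fun x => 2 * ∑ h : H with Γ.face h = i,
      Γ.corner x (Γ.next (Γ.next h)) := funext fun x => Γ.rho_eq_sum_corner x i
  rw [this]
  refine DifferentiableAt.const_mul (DifferentiableAt.fun_sum fun h _ => ?_) _
  have hcoord : ∀ e, DifferentiableAt ℝ (fun x : Γ.Edge → ℝ => x e) lam :=
    fun e => differentiableAt_apply e lam
  simp only [corner, div_eq_mul_inv]
  refine (hcoord _).fun_mul (((hcoord _).fun_mul (hcoord _)).fun_inv ?_)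
  exact mul_ne_zero (hlam _).ne' (hlam _).ne'

/-- At a point where all horocycles have nonzero length, these lengths are independent. -/
theorem surjective_fderiv_rho {lam : Γ.Edge → ℝ} (hlam : ∀ e, 0 < lam e)
    (hrho : ∀ i, Γ.rho lam i = 1) : Function.Surjective (fderiv ℝ Γ.rho lam) := by
  intro t
  set s : Γ.Face → ℝ := fun i => -(t i) / 2 with hs
  refine ⟨fun e => lam e * Γ.edgeWeight s e, ?_⟩
  have hw : ∀ τ : ℝ, ∀ e, Γ.edgeWeight (fun i => τ * s i) e = τ * Γ.edgeWeight s e := by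
    intro τ e
    simp only [edgeWeight]
    ring
  have hcurve : HasDerivAt (fun τ : ℝ => fun e => lam e * Real.exp (τ * Γ.edgeWeight s e))
      (fun e => lam e * Γ.edgeWeight s e) 0 := by
    rw [hasDerivAt_pi]
    intro e
    have := (((hasDerivAt_id (0 : ℝ)).mul_const (Γ.edgeWeight s e)).exp).const_mul (lam e)
    simpa using this
  have h0 : (fun e => lam e * Real.exp (0 * Γ.edgeWeight s e)) = lam := by
    ext e; simp
  have hcomp := HasFDerivAt.comp_hasDerivAt (0 : ℝ)
    (l := Γ.rho) (l' := fderiv ℝ Γ.rho lam) (by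
      rw [h0]
      exact (Γ.differentiableAt_rho hlam).hasFDerivAt) hcurve
  have hexp : HasDerivAt (fun τ : ℝ => fun i => Real.exp (τ * t i)) t 0 := by
    rw [hasDerivAt_pi]
    intro i
    simpa using ((hasDerivAt_id (0 : ℝ)).mul_const (t i)).exp
  have heq : (Γ.rho ∘ fun τ : ℝ => fun e => lam e * Real.exp (τ * Γ.edgeWeight s e))
      = fun τ : ℝ => fun i => Real.exp (τ * t i) := by
    funext τ i
    have := Γ.rho_scale lam (fun i => τ * s i) i
    simp only [hw] at this
    rw [Function.comp_apply, this, hrho, mul_one]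
    congr 1
    simp only [hs]
    ring
  rw [heq] at hcomp
  exact hcomp.unique hexp

/-! ### The triangle inequalities -/

/-- On the cell the edges at each vertex satisfy the strict triangle inequalities. If an edge is at
least as long as the other two edges at one of its ends together, then positivity of its simplicial
coordinate forces an even longer edge of this kind at its other end. -/
theorem lt_add_of_mem_cell {lam : Γ.Edge → ℝ} (hlam : lam ∈ Γ.cell) (h : H) :
    lam (Γ.edge h) < lam (Γ.edge (Γ.next h)) + lam (Γ.edge (Γ.next (Γ.next h))) := by
  classical
  obtain ⟨hpos, -, hX⟩ := hlam
  by_contra! hcon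
  obtain ⟨k, hk, hmax⟩ := Finset.exists_max_image (Finset.univ.filter fun h : H =>
    lam (Γ.edge (Γ.next h)) + lam (Γ.edge (Γ.next (Γ.next h))) ≤ lam (Γ.edge h))
    (fun h => lam (Γ.edge h)) ⟨h, by simpa using hcon⟩
  simp only [Finset.mem_filter, Finset.mem_univ, true_and] at hk hmax
  have key := hX (Γ.edge k)
  have hY : ∀ a b c : ℝ, 0 < a → 0 < b → 0 < c →
      b / (c * a) + c / (a * b) - a / (b * c) = (b ^ 2 + c ^ 2 - a ^ 2) / (a * b * c) := by
    intro a b c ha hb hc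
    field_simp
  rw [simplicialCoord_edge] at key
  simp only [corner, Γ.next_next_next, edge_flip] at key
  have m1 := hmax (Γ.next (Γ.flip k))
  have m2 := hmax (Γ.next (Γ.next (Γ.flip k)))
  simp only [Γ.next_next_next, edge_flip] at m1 m2
  have ha := hpos (Γ.edge k)
  have hb := hpos (Γ.edge (Γ.next k))
  have hc := hpos (Γ.edge (Γ.next (Γ.next k)))
  have hb' := hpos (Γ.edge (Γ.next (Γ.flip k)))
  have hc' := hpos (Γ.edge (Γ.next (Γ.next (Γ.flip k))))
  generalize lam (Γ.edge k) = a at *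
  generalize lam (Γ.edge (Γ.next k)) = b at *
  generalize lam (Γ.edge (Γ.next (Γ.next k))) = c at *
  generalize lam (Γ.edge (Γ.next (Γ.flip k))) = b' at *
  generalize lam (Γ.edge (Γ.next (Γ.next (Γ.flip k)))) = c' at *
  rw [hY a b c ha hb hc, hY a b' c' ha hb' hc'] at key
  have h1 : (b ^ 2 + c ^ 2 - a ^ 2) / (a * b * c) ≤ -(2 / a) := by
    rw [div_le_iff₀ (by positivity)]
    have : -(2 / a) * (a * b * c) = -(2 * b * c) := by field_simp
    rw [this]
    nlinarith
  have h2 : 2 / a < (b' ^ 2 + c' ^ 2 - a ^ 2) / (a * b' * c') := by linarith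
  rw [lt_div_iff₀ (by positivity), show 2 / a * (a * b' * c') = 2 * b' * c' by field_simp] at h2
  have h3 : a ^ 2 < (b' - c') ^ 2 := by linarith
  rw [sq_lt_sq, abs_of_pos ha, lt_abs] at h3
  rcases h3 with h3 | h3
  · have := m1 (by linarith)
    linarith
  · have := m2 (by linarith)
    linarith

/-! ### The Weil-Petersson form at the vertices -/

/-- The shape of the triangle dual to the vertex of `h`: the logarithms of the ratios of two of its
sides to the third one. -/
noncomputable def shape (h : H) (lam : Γ.Edge → ℝ) : ℝ × ℝ :=
  (Real.log (lam (Γ.edge h)) - Real.log (lam (Γ.edge (Γ.next (Γ.next h)))),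
    Real.log (lam (Γ.edge (Γ.next h))) - Real.log (lam (Γ.edge (Γ.next (Γ.next h)))))

theorem shape_mem_triangleShapes {lam : Γ.Edge → ℝ} (hlam : lam ∈ Γ.cell) (h : H) :
    Γ.shape h lam ∈ triangleShapes := by
  have h1 := Γ.lt_add_of_mem_cell hlam h
  have h2 := Γ.lt_add_of_mem_cell hlam (Γ.next h)
  have h3 := Γ.lt_add_of_mem_cell hlam (Γ.next (Γ.next h))
  simp only [Γ.next_next_next] at h1 h2 h3
  have p1 := hlam.1 (Γ.edge h)
  have p2 := hlam.1 (Γ.edge (Γ.next h))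
  have p3 := hlam.1 (Γ.edge (Γ.next (Γ.next h)))
  simp only [triangleShapes, shape, Set.mem_ofPred_eq, Real.exp_sub, Real.exp_log p1,
    Real.exp_log p2, Real.exp_log p3]
  refine ⟨?_, ?_, ?_⟩
  · rw [← add_div, lt_div_iff₀ p3]
    linarith
  · rw [div_add_one p3.ne', div_lt_div_iff_of_pos_right p3]
    linarith
  · rw [div_add_one p3.ne', div_lt_div_iff_of_pos_right p3]
    linarith

/-- The differential of the first component of the shape. -/
noncomputable def dshapeFst (lam : Γ.Edge → ℝ) (h : H) (u : Γ.Edge → ℝ) : ℝ :=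
  Γ.dlog lam (Γ.edge h) u - Γ.dlog lam (Γ.edge (Γ.next (Γ.next h))) u

/-- The differential of the second component of the shape. -/
noncomputable def dshapeSnd (lam : Γ.Edge → ℝ) (h : H) (u : Γ.Edge → ℝ) : ℝ :=
  Γ.dlog lam (Γ.edge (Γ.next h)) u - Γ.dlog lam (Γ.edge (Γ.next (Γ.next h))) u

/-- The Weil-Petersson form is a sum of decomposable forms, one for each vertex: the area forms of
the spaces of triangle shapes. -/
theorem omegaWP_eq_sum_vertex (lam : Γ.Edge → ℝ) :
    Γ.omegaWP lam = fun u w => -2 * ∑ v : Γ.Vertex,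
      (Γ.dshapeFst lam (Quotient.out v) u * Γ.dshapeSnd lam (Quotient.out v) w
        - Γ.dshapeFst lam (Quotient.out v) w * Γ.dshapeSnd lam (Quotient.out v) u) := by
  funext u w
  rw [omegaWP, Γ.sum_eq_sum_vertex]
  congr 1
  refine Finset.sum_congr rfl fun v _ => ?_
  simp only [dshapeFst, dshapeSnd, Γ.next_next_next]
  ring

end TrivalentFatgraph

/-! ### The triangle shapes at a choice of vertices -/

namespace TrivalentFatgraph

variable {H : Type*} (Γ : TrivalentFatgraph H) {m : ℕ}

/-- The edge whose `λ`-length is the numerator of the `r`-th shape coordinate at the vertices of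
`η`. -/
def topEdge (η : Fin m → H) (r : Fin (2 * m)) : Γ.Edge :=
  Γ.edge (bif ((pairEquiv m).symm r).2 then Γ.next (η ((pairEquiv m).symm r).1)
    else η ((pairEquiv m).symm r).1)

/-- The edge whose `λ`-length is the denominator of the `r`-th shape coordinate at the vertices of
`η`. -/
def baseEdge (η : Fin m → H) (r : Fin (2 * m)) : Γ.Edge :=
  Γ.edge (Γ.next (Γ.next (η ((pairEquiv m).symm r).1)))

/-- The shapes of the triangles at the vertices of the half-edges `η`, as a point of `ℝ ^ (2 m)`. -/
noncomputable def shapeMap (η : Fin m → H) (lam : Γ.Edge → ℝ) (r : Fin (2 * m)) : ℝ :=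
  Real.log (lam (Γ.topEdge η r)) - Real.log (lam (Γ.baseEdge η r))

theorem shapeMap_pair (η : Fin m → H) (lam : Γ.Edge → ℝ) (j : Fin m) :
    (Γ.shapeMap η lam (pairEquiv m (j, false)), Γ.shapeMap η lam (pairEquiv m (j, true)))
      = Γ.shape (η j) lam := by
  simp [shapeMap, shape, topEdge, baseEdge]

variable [Fintype H]

theorem contDiffAt_shapeMap (η : Fin m → H) {lam : Γ.Edge → ℝ} (hlam : ∀ e, 0 < lam e) :
    ContDiffAt ℝ 1 (Γ.shapeMap η) lam := by
  rw [contDiffAt_pi]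
  intro r
  have hcoord : ∀ e, ContDiffAt ℝ 1 (fun x : Γ.Edge → ℝ => Real.log (x e)) lam := fun e =>
    (contDiff_apply ℝ ℝ e).contDiffAt.log (hlam e).ne'
  exact (hcoord _).sub (hcoord _)

theorem fderiv_shapeMap_apply (η : Fin m → H) {lam : Γ.Edge → ℝ} (hlam : ∀ e, 0 < lam e)
    (u : Γ.Edge → ℝ) (r : Fin (2 * m)) :
    fderiv ℝ (Γ.shapeMap η) lam u r
      = Γ.dlog lam (Γ.topEdge η r) u - Γ.dlog lam (Γ.baseEdge η r) u := by
  have h1 := hasFDerivAt_pi'.1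
    ((Γ.contDiffAt_shapeMap η hlam).differentiableAt (by simp)).hasFDerivAt r
  have hcoord : ∀ e, HasFDerivAt (fun x : Γ.Edge → ℝ => Real.log (x e))
      ((lam e)⁻¹ • ContinuousLinearMap.proj (R := ℝ) (φ := fun _ : Γ.Edge => ℝ) e) lam := fun e =>
    (hasFDerivAt_apply e lam).log (hlam e).ne'
  have h2 := congrArg (fun L : (Γ.Edge → ℝ) →L[ℝ] ℝ => L u)
    (h1.unique ((hcoord (Γ.topEdge η r)).sub (hcoord (Γ.baseEdge η r))))
  simpa [dlog, div_eq_inv_mul] using h2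

theorem fderiv_shapeMap_eq_dshape (η : Fin m → H) {lam : Γ.Edge → ℝ} (hlam : ∀ e, 0 < lam e)
    (u : Γ.Edge → ℝ) (r : Fin (2 * m)) :
    fderiv ℝ (Γ.shapeMap η) lam u r
      = (bif ((pairEquiv m).symm r).2 then Γ.dshapeSnd lam else Γ.dshapeFst lam)
        (η ((pairEquiv m).symm r).1) u := by
  rw [Γ.fderiv_shapeMap_apply η hlam, topEdge, baseEdge]
  cases ((pairEquiv m).symm r).2 <;> rfl

/-! ### The polynomial system that determines a point of the cell -/

section Polynomials

open MvPolynomial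

open Classical in
/-- The product of the squares of all `λ`-lengths, divided by those of `a` and `b`. -/
noncomputable def reducedSquares (a b : Γ.Edge) : MvPolynomial Γ.Edge ℝ :=
  ∏ e, X e ^ (2 - (if e = a then 1 else 0) - (if e = b then 1 else 0))

open Classical in
/-- The equation `ρ_i = 1`, multiplied by the squares of all `λ`-lengths. -/
noncomputable def rhoPoly (i : Γ.Face) : MvPolynomial Γ.Edge ℝ :=
  (∑ h : H with Γ.face h = i, C 2 * (X (Γ.edge (Γ.next h)) *
    Γ.reducedSquares (Γ.edge (Γ.next (Γ.next h))) (Γ.edge h))) - ∏ e, X e ^ 2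

theorem eval_reducedSquares_mul (a b : Γ.Edge) (x : Γ.Edge → ℝ) :
    eval x (Γ.reducedSquares a b) * (x a * x b) = ∏ e, x e ^ 2 := by
  classical
  have h1 : ∀ a, x a = ∏ e, x e ^ (if e = a then 1 else 0) := fun a => by
    simp [pow_ite, Finset.prod_ite_eq']
  rw [reducedSquares, map_prod]
  conv_lhs => rw [h1 a, h1 b, ← Finset.prod_mul_distrib, ← Finset.prod_mul_distrib]
  refine Finset.prod_congr rfl fun e _ => ?_
  rw [map_pow, eval_X, ← pow_add, ← pow_add]
  congr 1
  split_ifs <;> rfl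

theorem eval_rhoPoly (i : Γ.Face) {x : Γ.Edge → ℝ} (hx : ∀ e, 0 < x e) :
    eval x (Γ.rhoPoly i) = (∏ e, x e ^ 2) * (Γ.rho x i - 1) := by
  classical
  rw [rhoPoly, rho_eq_sum_corner, mul_sub, mul_one, map_sub, map_sum, map_prod]
  congr 1
  · rw [Finset.mul_sum, Finset.mul_sum]
    refine Finset.sum_congr rfl fun h _ => ?_
    rw [← Γ.eval_reducedSquares_mul (Γ.edge (Γ.next (Γ.next h))) (Γ.edge h) x]
    simp only [corner, Γ.next_next_next, map_mul, eval_C, eval_X]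
    have h1 := (hx (Γ.edge h)).ne'
    have h2 := (hx (Γ.edge (Γ.next (Γ.next h)))).ne'
    field_simp
  · simp

theorem totalDegree_rhoPoly_le (i : Γ.Face) :
    (Γ.rhoPoly i).totalDegree ≤ 2 * Fintype.card Γ.Edge := by
  classical
  have hX : ∀ (e : Γ.Edge) (k : ℕ), (X e ^ k : MvPolynomial Γ.Edge ℝ).totalDegree ≤ k := by
    intro e k
    refine (totalDegree_pow _ _).trans ?_
    rw [totalDegree_X, mul_one]
  refine (totalDegree_sub _ _).trans (max_le ?_ ?_)
  · refine totalDegree_finsetSum_le fun h _ => ?_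
    refine (totalDegree_mul _ _).trans ?_
    rw [totalDegree_C, zero_add]
    refine (totalDegree_mul _ _).trans ?_
    have h1 : (Γ.reducedSquares (Γ.edge (Γ.next (Γ.next h))) (Γ.edge h)).totalDegree
        ≤ ∑ e : Γ.Edge, (2 - if e = Γ.edge h then 1 else 0) := by
      refine (totalDegree_finsetProd _ _).trans (Finset.sum_le_sum fun e _ => (hX e _).trans ?_)
      omega
    have h2 : ∑ e : Γ.Edge, (2 - if e = Γ.edge h then 1 else 0)
        + ∑ e : Γ.Edge, (if e = Γ.edge h then 1 else 0) = 2 * Fintype.card Γ.Edge := by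
      rw [← Finset.sum_add_distrib, Finset.sum_congr rfl (g := fun _ => 2)]
      · simp [mul_comm]
      · intro e _
        split_ifs <;> rfl
    rw [Finset.sum_ite_eq' Finset.univ, if_pos (Finset.mem_univ _)] at h2
    rw [totalDegree_X]
    omega
  · refine (totalDegree_finsetProd _ _).trans ((Finset.sum_le_sum fun e _ => hX e 2).trans ?_)
    simp [mul_comm]

theorem fderiv_eval_rhoPoly (i : Γ.Face) {z : Γ.Edge → ℝ} (hz : ∀ e, 0 < z e)
    (hrho : Γ.rho z i = 1) (u : Γ.Edge → ℝ) :
    fderiv ℝ (fun x => eval x (Γ.rhoPoly i)) z u = (∏ e, z e ^ 2) * fderiv ℝ Γ.rho z u i := by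
  have hev : (fun x => eval x (Γ.rhoPoly i)) =ᶠ[nhds z]
      fun x => (∏ e, x e ^ 2) * (Γ.rho x i - 1) := by
    have h1 : ∀ᶠ x in nhds z, ∀ e, 0 < x e := Filter.eventually_all.2 fun e =>
      (continuous_apply e).continuousAt.eventually_const_lt (hz e)
    filter_upwards [h1] with x hx
    exact Γ.eval_rhoPoly i hx
  have hM : DifferentiableAt ℝ (fun x : Γ.Edge → ℝ => ∏ e, x e ^ 2) z := by
    have h1 : (fun x : Γ.Edge → ℝ => ∏ e, x e ^ 2) = fun x => eval x (∏ e : Γ.Edge, X e ^ 2) := by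
      funext x
      rw [map_prod]
      exact Finset.prod_congr rfl fun e _ => by rw [map_pow, eval_X]
    rw [h1]
    exact (contDiff_eval (n := 1) _).differentiable (by simp) z
  have hr := hasFDerivAt_pi'.1 (Γ.differentiableAt_rho hz).hasFDerivAt i
  rw [hev.fderiv_eq, (hM.hasFDerivAt.fun_mul (hr.sub_const 1)).fderiv]
  simp [hrho]

/-- At most `(2 N) ^ n` nondegenerate points of the cell have the same shapes at the vertices of
`η`: equality of shapes is a system of linear equations in the `λ`-lengths, and each of the `n`
equations `ρ_i = 1` is polynomial of degree at most `2 N`. -/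
theorem card_le_of_shapeMap_eq (η : Fin m → H)
    (hcard : Fintype.card Γ.Edge = 2 * m + Fintype.card Γ.Face) (y : Fin (2 * m) → ℝ)
    (Z : Finset (Γ.Edge → ℝ)) (hcell : ∀ z ∈ Z, z ∈ Γ.cell) (hy : ∀ z ∈ Z, Γ.shapeMap η z = y)
    (hnd : ∀ z ∈ Z, ∀ u, fderiv ℝ Γ.rho z u = 0 → fderiv ℝ (Γ.shapeMap η) z u = 0 → u = 0) :
    Z.card ≤ (2 * Fintype.card Γ.Edge) ^ Fintype.card Γ.Face := by
  classical
  have hκ : Fintype.card (Fin (2 * m) ⊕ Γ.Face) = Fintype.card Γ.Edge := by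
    rw [Fintype.card_sum, Fintype.card_fin, hcard]
  let σ : Fin (2 * m) ⊕ Γ.Face ≃ Γ.Edge := Fintype.equivOfCardEq hκ
  let f : Fin (2 * m) ⊕ Γ.Face → MvPolynomial Γ.Edge ℝ := Sum.elim
    (fun r => X (Γ.topEdge η r) - C (Real.exp (y r)) * X (Γ.baseEdge η r)) Γ.rhoPoly
  let d : Fin (2 * m) ⊕ Γ.Face → ℕ := Sum.elim (fun _ => 1) fun _ => 2 * Fintype.card Γ.Edge
  obtain ⟨h₀⟩ := Γ.nonempty
  have hN : 0 < Fintype.card Γ.Edge := Fintype.card_pos_iff.2 ⟨Γ.edge h₀⟩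
  have hd0 : ∀ q, 0 < d q := by
    rintro (r | i)
    · exact one_pos
    · exact Nat.mul_pos two_pos hN
  have hd : ∀ q, (f q).totalDegree ≤ d q := by
    rintro (r | i)
    · refine (totalDegree_sub _ _).trans (max_le (totalDegree_X _).le ?_)
      refine (totalDegree_mul _ _).trans ?_
      rw [totalDegree_C, totalDegree_X]
      exact le_rfl
    · exact Γ.totalDegree_rhoPoly_le i
  have hratio : ∀ z ∈ Z, ∀ r, Real.exp (y r) = z (Γ.topEdge η r) / z (Γ.baseEdge η r) := by
    intro z hz r
    rw [← hy z hz, shapeMap, Real.exp_sub, Real.exp_log ((hcell z hz).1 _),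
      Real.exp_log ((hcell z hz).1 _)]
  have hzero : ∀ z ∈ Z, ∀ q, eval z (f q) = 0 := by
    rintro z hz (r | i)
    · have := ((hcell z hz).1 (Γ.baseEdge η r)).ne'
      simp only [f, Sum.elim_inl, map_sub, map_mul, eval_X, eval_C, hratio z hz r]
      field_simp
      ring
    · simp only [f, Sum.elim_inr]
      rw [Γ.eval_rhoPoly i (hcell z hz).1, (hcell z hz).2.1 i, sub_self, mul_zero]
  have hnd' : ∀ z ∈ Z, ∀ u, (∀ q, fderiv ℝ (fun x => eval x (f q)) z u = 0) → u = 0 := by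
    intro z hz u hu
    have hpos := (hcell z hz).1
    refine hnd z hz u ?_ ?_
    · ext i
      have h1 := hu (Sum.inr i)
      simp only [f, Sum.elim_inr] at h1
      rw [Γ.fderiv_eval_rhoPoly i hpos ((hcell z hz).2.1 i)] at h1
      exact (mul_eq_zero.1 h1).resolve_left
        (Finset.prod_pos fun e _ => pow_pos (hpos e) 2).ne'
    · ext r
      have h1 := hu (Sum.inl r)
      have h2 : HasFDerivAt (fun x : Γ.Edge → ℝ => eval x (f (Sum.inl r)))
          (ContinuousLinearMap.proj (R := ℝ) (φ := fun _ : Γ.Edge => ℝ) (Γ.topEdge η r)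
            - Real.exp (y r) •
              ContinuousLinearMap.proj (R := ℝ) (φ := fun _ : Γ.Edge => ℝ) (Γ.baseEdge η r)) z := by
        simp only [f, Sum.elim_inl, map_sub, map_mul, eval_X, eval_C]
        exact (hasFDerivAt_apply _ z).fun_sub ((hasFDerivAt_apply _ z).const_mul _)
      rw [h2.fderiv, hratio z hz r] at h1
      rw [Γ.fderiv_shapeMap_apply η hpos]
      simp only [sub_apply, smul_apply, ContinuousLinearMap.proj_apply, smul_eq_mul] at h1
      have e1 := (hpos (Γ.topEdge η r)).ne'
      have e2 := (hpos (Γ.baseEdge η r)).ne'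
      simp only [dlog, Pi.zero_apply]
      rw [sub_eq_zero] at h1 ⊢
      rw [h1]
      field_simp
  have hbez := card_nondegenerate_zeros_le (fun e => f (σ.symm e)) (fun e => d (σ.symm e))
    (fun e => hd0 _) (fun e => hd _) Z (fun z hz e => hzero z hz _)
    (fun z hz u hu => hnd' z hz u fun q => by simpa using hu (σ q))
  rw [Equiv.prod_comp σ.symm d, Fintype.prod_sum_type] at hbez
  simpa [d] using hbez

end Polynomials

/-! ### Parametrizations of the cell -/

section Parametrization

variable {U : Set (Fin (2 * m) → ℝ)} {φ : (Fin (2 * m) → ℝ) → (Γ.Edge → ℝ)}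

theorem contDiffOn_shapeMap_comp (η : Fin m → H) (hφ : ContDiffOn ℝ 1 φ U)
    (hmaps : Set.MapsTo φ U Γ.cell) : ContDiffOn ℝ 1 (fun x => Γ.shapeMap η (φ x)) U :=
  fun x hx => (Γ.contDiffAt_shapeMap η (hmaps hx).1).comp_contDiffWithinAt x (hφ x hx)

theorem fderiv_shapeMap_comp (η : Fin m → H) (hU : IsOpen U) (hφ : ContDiffOn ℝ 1 φ U)
    (hmaps : Set.MapsTo φ U Γ.cell) {x : Fin (2 * m) → ℝ} (hx : x ∈ U) :
    fderiv ℝ (fun x => Γ.shapeMap η (φ x)) x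
      = (fderiv ℝ (Γ.shapeMap η) (φ x)).comp (fderiv ℝ φ x) :=
  fderiv_comp x ((Γ.contDiffAt_shapeMap η (hmaps hx).1).differentiableAt (by simp))
    ((hφ.differentiableOn (by simp) x hx).differentiableAt (hU.mem_nhds hx))

theorem det_fderiv_shapeMap_comp (η : Fin m → H) (hU : IsOpen U) (hφ : ContDiffOn ℝ 1 φ U)
    (hmaps : Set.MapsTo φ U Γ.cell) {x : Fin (2 * m) → ℝ} (hx : x ∈ U) :
    (fderiv ℝ (fun x => Γ.shapeMap η (φ x)) x).det = Matrix.det (Matrix.of fun r k : Fin (2 * m) =>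
      (bif ((pairEquiv m).symm r).2 then Γ.dshapeSnd (φ x) else Γ.dshapeFst (φ x))
        (η ((pairEquiv m).symm r).1) (fderiv ℝ φ x (Pi.single k 1))) := by
  rw [ContinuousLinearMap.det, ← LinearMap.det_toMatrix', Γ.fderiv_shapeMap_comp η hU hφ hmaps hx]
  congr 1
  ext r k
  rw [LinearMap.toMatrix'_apply, Matrix.of_apply, ← Γ.fderiv_shapeMap_eq_dshape η (hmaps hx).1]
  rfl

/-- Where the shape coordinates are local coordinates of the cell, they and the lengths of the
horocycles are local coordinates of the whole space: the tangent space of the cell is the full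
kernel of the differential of `ρ`, by dimension. -/
theorem eq_zero_of_fderiv_eq_zero (η : Fin m → H)
    (hcard : Fintype.card Γ.Edge = 2 * m + Fintype.card Γ.Face)
    (hU : IsOpen U) (hφ : ContDiffOn ℝ 1 φ U)
    (hmaps : Set.MapsTo φ U Γ.cell) {x : Fin (2 * m) → ℝ} (hx : x ∈ U)
    (hdet : (fderiv ℝ (fun x => Γ.shapeMap η (φ x)) x).det ≠ 0) (u : Γ.Edge → ℝ)
    (hrho : fderiv ℝ Γ.rho (φ x) u = 0) (hshape : fderiv ℝ (Γ.shapeMap η) (φ x) u = 0) : u = 0 := by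
  obtain ⟨hpos, h1, -⟩ := hmaps hx
  rw [Γ.fderiv_shapeMap_comp η hU hφ hmaps hx] at hdet
  set A := fderiv ℝ φ x
  set B := fderiv ℝ (Γ.shapeMap η) (φ x)
  set L := fderiv ℝ Γ.rho (φ x)
  have hBA : Function.Injective (B.comp A) := by
    let e := (B.comp A).toContinuousLinearEquivOfDetNeZero hdet
    have he : (e : (Fin (2 * m) → ℝ) →L[ℝ] (Fin (2 * m) → ℝ)) = B.comp A :=
      ContinuousLinearMap.coe_toContinuousLinearEquivOfDetNeZero _ hdet
    rw [← he]
    exact e.injective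
  have hA : Function.Injective A := fun a b hab => hBA (congrArg B hab)
  have hLA : L.comp A = 0 := by
    have hφx : DifferentiableAt ℝ φ x :=
      (hφ.differentiableOn (by simp) x hx).differentiableAt (hU.mem_nhds hx)
    have h2 : fderiv ℝ (fun x => Γ.rho (φ x)) x = L.comp A :=
      fderiv_comp x (Γ.differentiableAt_rho hpos) hφx
    have h3 : (fun x => Γ.rho (φ x)) =ᶠ[nhds x] fun _ _ => 1 := by
      filter_upwards [hU.mem_nhds hx] with x' hx'
      exact funext fun i => (hmaps hx').2.1 i
    rw [← h2, h3.fderiv_eq, fderiv_fun_const]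
    rfl
  have hle : LinearMap.range (A : (Fin (2 * m) → ℝ) →ₗ[ℝ] (Γ.Edge → ℝ))
      ≤ LinearMap.ker (L : (Γ.Edge → ℝ) →ₗ[ℝ] (Γ.Face → ℝ)) := by
    rintro _ ⟨w, rfl⟩
    exact congrArg (fun K : (Fin (2 * m) → ℝ) →L[ℝ] (Γ.Face → ℝ) => K w) hLA
  have hsurj : Function.Surjective (L : (Γ.Edge → ℝ) →ₗ[ℝ] (Γ.Face → ℝ)) :=
    Γ.surjective_fderiv_rho hpos h1
  have r1 := LinearMap.finrank_range_add_finrank_ker (L : (Γ.Edge → ℝ) →ₗ[ℝ] (Γ.Face → ℝ))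
  rw [LinearMap.range_eq_top.2 hsurj, finrank_top, Module.finrank_fintype_fun_eq_card,
    Module.finrank_fintype_fun_eq_card] at r1
  have r2 := LinearMap.finrank_range_of_inj
    (f := (A : (Fin (2 * m) → ℝ) →ₗ[ℝ] (Γ.Edge → ℝ))) hA
  rw [Module.finrank_fintype_fun_eq_card, Fintype.card_fin] at r2
  have heq := Submodule.eq_of_le_of_finrank_eq hle (by omega)
  have hu : u ∈ LinearMap.ker (L : (Γ.Edge → ℝ) →ₗ[ℝ] (Γ.Face → ℝ)) := hrho
  rw [← heq] at hu
  obtain ⟨w, rfl⟩ := hu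
  have hw : w = 0 := hBA (by rw [map_zero]; exact hshape)
  rw [hw, map_zero]

end Parametrization

end TrivalentFatgraph

/-! ### The bound for the volume -/

namespace TrivalentFatgraph

variable {H : Type*} (Γ : TrivalentFatgraph H) {m : ℕ} [Fintype H]

open MeasureTheory in
/-- The integral over disjoint parametrized pieces of the cell of the product of the area forms at
the vertices of `η`. -/
theorem tsum_lintegral_det_shapeMap_le (η : Fin m → H)
    (hcard : Fintype.card Γ.Edge = 2 * m + Fintype.card Γ.Face)
    {U : ℕ → Set (Fin (2 * m) → ℝ)} {φ : ℕ → (Fin (2 * m) → ℝ) → (Γ.Edge → ℝ)}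
    (hφ : ∀ j, IsOpen (U j) ∧ ContDiffOn ℝ 1 (φ j) (U j) ∧ Set.InjOn (φ j) (U j) ∧
      Set.MapsTo (φ j) (U j) Γ.cell)
    (hdisj : Pairwise fun i j => Disjoint (φ i '' U i) (φ j '' U j)) :
    ∑' j, ∫⁻ x in U j, ENNReal.ofReal |(fderiv ℝ (fun x => Γ.shapeMap η (φ j x)) x).det|
      ≤ ((2 * Fintype.card Γ.Edge) ^ Fintype.card Γ.Face : ℕ) * 5 ^ m := by
  classical
  have hvol := volume_setOf_pairs_mem m triangleShapes isOpen_triangleShapes.measurableSet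
  have := tsum_lintegral_abs_det_fderiv_le volume (fun j => (hφ j).1)
    (ψ := fun j x => Γ.shapeMap η (φ j x))
    (fun j => Γ.contDiffOn_shapeMap_comp η (hφ j).2.1 (hφ j).2.2.2)
    {y : Fin (2 * m) → ℝ | ∀ j, (y (pairEquiv m (j, false)), y (pairEquiv m (j, true)))
      ∈ triangleShapes}
    (fun j x hx _ k => by
      rw [Γ.shapeMap_pair]
      exact Γ.shape_mem_triangleShapes ((hφ j).2.2.2 hx) _)
    ((2 * Fintype.card Γ.Edge) ^ Fintype.card Γ.Face) ?_
  · refine this.trans ?_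
    rw [hvol]
    gcongr
    exact volume_triangleShapes_le
  · intro y T hT
    have hinj : Set.InjOn (fun p : ℕ × (Fin (2 * m) → ℝ) => φ p.1 p.2) T := by
      intro p hp q hq hpq
      have h1 : p.1 = q.1 := by
        by_contra hne
        exact Set.disjoint_left.1 (hdisj hne) (Set.mem_image_of_mem _ (hT p hp).1)
          (by simp only at hpq; rw [hpq]; exact Set.mem_image_of_mem _ (hT q hq).1)
      refine Prod.ext h1 ((hφ p.1).2.2.1 (hT p hp).1 (by rw [h1]; exact (hT q hq).1) ?_)
      simp only at hpq
      rw [hpq, h1]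
    rw [← Finset.card_image_of_injOn hinj]
    refine Γ.card_le_of_shapeMap_eq η hcard y _ ?_ ?_ ?_
    · intro z hz
      obtain ⟨p, hp, rfl⟩ := Finset.mem_image.1 hz
      exact (hφ p.1).2.2.2 (hT p hp).1
    · intro z hz
      obtain ⟨p, hp, rfl⟩ := Finset.mem_image.1 hz
      exact (hT p hp).2.2
    · intro z hz
      obtain ⟨p, hp, rfl⟩ := Finset.mem_image.1 hz
      exact Γ.eq_zero_of_fderiv_eq_zero η hcard (hφ p.1).1 (hφ p.1).2.1 (hφ p.1).2.2.2
        (hT p hp).1 (hT p hp).2.1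

open Classical in
/-- The Weil-Petersson volume density is at most `2 ^ m / m!` times the sum, over the choices of `m`
distinct vertices, of the densities of the products of the area forms at these vertices. -/
theorem abs_wedgePow_omegaWP_le {U : Set (Fin (2 * m) → ℝ)}
    {φ : (Fin (2 * m) → ℝ) → (Γ.Edge → ℝ)} (hU : IsOpen U) (hφ : ContDiffOn ℝ 1 φ U)
    (hmaps : Set.MapsTo φ U Γ.cell) {x : Fin (2 * m) → ℝ} (hx : x ∈ U) :
    |wedgePow (Γ.omegaWP (φ x)) m (fun i => fderiv ℝ φ x (Pi.single i 1)) / (m.factorial : ℝ)|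
      ≤ ∑ f : Fin m ↪ Γ.Vertex, 2 ^ m / (m.factorial : ℝ) *
        |(fderiv ℝ (fun x => Γ.shapeMap (fun j => Quotient.out (f j)) (φ x)) x).det| := by
  set D : (Fin m → Γ.Vertex) → ℝ := fun f =>
    (fderiv ℝ (fun x => Γ.shapeMap (fun j => Quotient.out (f j)) (φ x)) x).det with hD
  have hDdet : ∀ f, D f = Matrix.det (Matrix.of fun r k : Fin (2 * m) =>
      (bif ((pairEquiv m).symm r).2
        then fun v : Γ.Vertex => Γ.dshapeSnd (φ x) (Quotient.out v)
        else fun v : Γ.Vertex => Γ.dshapeFst (φ x) (Quotient.out v))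
        (f ((pairEquiv m).symm r).1) (fderiv ℝ φ x (Pi.single k 1))) := by
    intro f
    rw [hD]
    simp only
    rw [Γ.det_fderiv_shapeMap_comp (fun j => Quotient.out (f j)) hU hφ hmaps hx]
    congr 2
    ext r k
    cases ((pairEquiv m).symm r).2 <;> rfl
  have hwedge : wedgePow (Γ.omegaWP (φ x)) m (fun i => fderiv ℝ φ x (Pi.single i 1))
      = (-2) ^ m * ∑ f : Fin m → Γ.Vertex, D f := by
    rw [Γ.omegaWP_eq_sum_vertex, wedgePow_sum_decomposable (-2)
      (fun v : Γ.Vertex => Γ.dshapeFst (φ x) (Quotient.out v))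
      (fun v : Γ.Vertex => Γ.dshapeSnd (φ x) (Quotient.out v))]
    simp only [hDdet]
  have hzero : ∀ f : Fin m → Γ.Vertex, ¬ Function.Injective f → D f = 0 := by
    intro f hf
    rw [hDdet]
    convert det_pairRows_eq_zero
      (fun (v : Γ.Vertex) k => Γ.dshapeFst (φ x) (Quotient.out v) (fderiv ℝ φ x (Pi.single k 1)))
      (fun (v : Γ.Vertex) k => Γ.dshapeSnd (φ x) (Quotient.out v) (fderiv ℝ φ x (Pi.single k 1)))
      f hf using 3
    ext r k
    cases ((pairEquiv m).symm r).2 <;> rfl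
  have hsum : ∑ f : Fin m → Γ.Vertex, D f = ∑ f : Fin m ↪ Γ.Vertex, D f := by
    symm
    refine Finset.sum_of_injOn (fun f : Fin m ↪ Γ.Vertex => (f : Fin m → Γ.Vertex))
      DFunLike.coe_injective.injOn (fun f _ => Finset.mem_coe.2 (Finset.mem_univ _)) ?_
      (fun f _ => rfl)
    intro f _ hf
    refine hzero f fun hinj => hf ?_
    exact ⟨⟨f, hinj⟩, Finset.mem_coe.2 (Finset.mem_univ _), rfl⟩
  rw [hwedge, hsum, abs_div, abs_mul, abs_pow, abs_neg, Nat.abs_cast, abs_two, mul_div_right_comm,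
    ← Finset.mul_sum]
  gcongr
  exact Finset.abs_sum_le_sum_abs _ _

open MeasureTheory in
/-- The volume of the cell is at most `C(V, m) 10 ^ m (2 N) ^ n`. -/
theorem cellVolume_le (hcard : Fintype.card Γ.Edge = 2 * m + Fintype.card Γ.Face) :
    Γ.cellVolume m ≤ ((Fintype.card Γ.Vertex).choose m * 10 ^ m *
      (2 * Fintype.card Γ.Edge) ^ Fintype.card Γ.Face : ℕ) := by
  classical
  rw [cellVolume, integralDensity]
  refine iSup_le fun U => iSup_le fun φ => iSup_le fun hφ => iSup_le fun hdisj => ?_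
  set D : (Fin m ↪ Γ.Vertex) → ℕ → (Fin (2 * m) → ℝ) → ℝ≥0∞ := fun f j x =>
    ENNReal.ofReal |(fderiv ℝ (fun x => Γ.shapeMap (fun i => Quotient.out (f i)) (φ j x)) x).det|
    with hD
  set c : ℝ≥0∞ := ENNReal.ofReal (2 ^ m / (m.factorial : ℝ)) with hc
  have hmeas : ∀ f j, AEMeasurable (D f j) (volume.restrict (U j)) := by
    intro f j
    have h1 := ((Γ.contDiffOn_shapeMap_comp (fun i => Quotient.out (f i)) (hφ j).2.1
      (hφ j).2.2.2).continuousOn_fderiv_of_isOpen (hφ j).1 le_rfl)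
    have h2 := (ContinuousLinearMap.continuous_det.comp_continuousOn h1).abs
    exact (h2.aemeasurable (hφ j).1.measurableSet).ennreal_ofReal
  have hpiece : ∀ j, ∫⁻ x in U j, ENNReal.ofReal
      |wedgePow (Γ.omegaWP (φ j x)) m (fun i => fderiv ℝ (φ j) x (Pi.single i 1))
        / (m.factorial : ℝ)| ≤ ∑ f, c * ∫⁻ x in U j, D f j x := by
    intro j
    calc _ ≤ ∫⁻ x in U j, ∑ f, c * D f j x := by
          refine setLIntegral_mono' (hφ j).1.measurableSet fun x hx => ?_
          refine (ENNReal.ofReal_le_ofReal (Γ.abs_wedgePow_omegaWP_le (hφ j).1 (hφ j).2.1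
            (hφ j).2.2.2 hx)).trans_eq ?_
          rw [ENNReal.ofReal_sum_of_nonneg fun f _ => by positivity]
          exact Finset.sum_congr rfl fun f _ => ENNReal.ofReal_mul (by positivity)
      _ = ∑ f, c * ∫⁻ x in U j, D f j x := by
          rw [lintegral_finsetSum' _ fun f _ => (hmeas f j).const_mul c]
          exact Finset.sum_congr rfl fun f _ => lintegral_const_mul'' c (hmeas f j)
  calc _ ≤ ∑' j, ∑ f, c * ∫⁻ x in U j, D f j x := ENNReal.tsum_le_tsum hpiece
    _ = ∑ f, c * ∑' j, ∫⁻ x in U j, D f j x := by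
        rw [Summable.tsum_finsetSum fun f _ => ENNReal.summable]
        exact Finset.sum_congr rfl fun f _ => ENNReal.tsum_mul_left
    _ ≤ ∑ _f : Fin m ↪ Γ.Vertex,
          c * (((2 * Fintype.card Γ.Edge) ^ Fintype.card Γ.Face : ℕ) * 5 ^ m) := by
        gcongr with f _
        exact Γ.tsum_lintegral_det_shapeMap_le _ hcard hφ hdisj
    _ = _ := by
        rw [Finset.sum_const, Finset.card_univ, Fintype.card_embedding_eq, Fintype.card_fin,
          Nat.descFactorial_eq_factorial_mul_choose, nsmul_eq_mul, hc,
          ENNReal.ofReal_div_of_pos (by positivity), ENNReal.ofReal_natCast,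
          ENNReal.ofReal_pow zero_le_two, ENNReal.ofReal_ofNat]
        push_cast
        have h1 : (m.factorial : ℝ≥0∞) ≠ 0 := by exact_mod_cast m.factorial_ne_zero
        have h2 : (m.factorial : ℝ≥0∞) * (m.factorial : ℝ≥0∞)⁻¹ = 1 :=
          ENNReal.mul_inv_cancel h1 (ENNReal.natCast_ne_top _)
        rw [show (10 : ℝ≥0∞) = 2 * 5 by norm_num, mul_pow 2 5, div_eq_mul_inv]
        calc _ = ((m.factorial : ℝ≥0∞) * (m.factorial : ℝ≥0∞)⁻¹) *
              (((Fintype.card Γ.Vertex).choose m : ℝ≥0∞) * (2 ^ m * 5 ^ m)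
                * (2 * (Fintype.card Γ.Edge : ℝ≥0∞)) ^ Fintype.card Γ.Face) := by ring
          _ = _ := by rw [h2, one_mul]

end TrivalentFatgraph

theorem mainTheorem2 {H : Type*} [Fintype H] (Γ : TrivalentFatgraph H) (g n V N m : ℕ)
    (hΓ : Γ.HasType g n) (hV : V + 4 = 4 * g + 2 * n) (hN : N + 6 = 6 * g + 3 * n)
    (hm : m + 3 = 3 * g + n) :
    Γ.cellVolume m <
        ENNReal.ofReal ((2 : ℝ) ^ N * 3 ^ V * (N : ℝ) ^ n *
          (8 / 3 : ℝ) ^ (((N : ℝ) - 1) / 2) * (2 * (V : ℝ)) ^ n) ∧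
      (n = 1 →
        Γ.cellVolume m <
          ENNReal.ofReal ((2 : ℝ) ^ (4 * (g : ℤ) - 2) * 3 ^ V *
            (8 / 3 : ℝ) ^ (((N : ℝ) - 1) / 2) * (N : ℝ))) := by
  obtain ⟨hF, hχ⟩ := hΓ
  have c1 := Γ.card_halfEdge_eq_three_mul
  have c2 := Γ.card_halfEdge_eq_two_mul
  rw [Nat.card_eq_fintype_card] at hF
  rw [Nat.card_eq_fintype_card, Nat.card_eq_fintype_card] at hχ
  have hcV : Fintype.card Γ.Vertex = V := by omega
  have hcN : Fintype.card Γ.Edge = N := by omega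
  obtain ⟨h₀⟩ := Γ.nonempty
  have hn : 1 ≤ n := by
    rw [← hF]
    exact Fintype.card_pos_iff.2 ⟨Γ.face h₀⟩
  have hV1 : 1 ≤ V := by
    rw [← hcV]
    exact Fintype.card_pos_iff.2 ⟨Γ.vertex h₀⟩
  have hvol := Γ.cellVolume_le (m := m) (by omega)
  rw [hcV, hcN, hF] at hvol
  have hbound : ∀ B : ℝ, 2 ^ V * 10 ^ m * (2 * (N : ℝ)) ^ n < B →
      Γ.cellVolume m < ENNReal.ofReal B := by
    intro B hB
    refine hvol.trans_lt ?_
    rw [← ENNReal.ofReal_natCast]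
    refine ENNReal.ofReal_lt_ofReal_iff_of_nonneg (by positivity) |>.2 (lt_of_le_of_lt ?_ hB)
    push_cast
    gcongr
    exact_mod_cast Nat.choose_le_two_pow V m
  have hN0 : (0 : ℝ) < N := by
    have : 0 < N := by omega
    exact_mod_cast this
  have h83 : (0 : ℝ) < (8 / 3 : ℝ) ^ (((N : ℝ) - 1) / 2) := by positivity
  refine ⟨hbound _ ?_, fun hn1 => hbound _ ?_⟩
  · obtain ⟨k, rfl⟩ : ∃ k, V = 2 * k := ⟨V / 2, by omega⟩
    obtain rfl : N = 3 * k := by omega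
    have hk : 1 ≤ k := by omega
    have hmk : (m : ℝ) ≤ (((3 * k : ℕ) : ℝ) - 1) / 2 := by
      have : 2 * m + 1 ≤ 3 * k := by omega
      have : (2 * m + 1 : ℝ) ≤ ((3 * k : ℕ) : ℝ) := by exact_mod_cast this
      linarith
    -- As `10 ≤ 4 * (8 / 3)`, it remains to compare `4 ^ ((N - 1) / 2)` with `2 ^ (N - V) * 3 ^ V`.
    have h10 : (10 : ℝ) ^ m ≤ 2 ^ (3 * k - 1) * (8 / 3 : ℝ) ^ ((((3 * k : ℕ) : ℝ) - 1) / 2) := by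
      calc (10 : ℝ) ^ m = (10 : ℝ) ^ (m : ℝ) := (Real.rpow_natCast _ _).symm
        _ ≤ (10 : ℝ) ^ ((((3 * k : ℕ) : ℝ) - 1) / 2) :=
            Real.rpow_le_rpow_of_exponent_le (by norm_num) hmk
        _ ≤ (4 * (8 / 3) : ℝ) ^ ((((3 * k : ℕ) : ℝ) - 1) / 2) :=
            Real.rpow_le_rpow (by norm_num) (by norm_num) (le_trans (Nat.cast_nonneg m) hmk)
        _ = _ := by
            rw [Real.mul_rpow (by norm_num) (by norm_num)]
            congr 1
            rw [show (4 : ℝ) = 2 ^ (2 : ℝ) by norm_num, ← Real.rpow_mul (by norm_num),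
              ← Real.rpow_natCast, Nat.cast_sub (by omega)]
            congr 1
            push_cast
            ring
    have hNn : (2 * ((3 * k : ℕ) : ℝ)) ^ n
        ≤ ((3 * k : ℕ) : ℝ) ^ n * (2 * ((2 * k : ℕ) : ℝ)) ^ n := by
      rw [← mul_pow]
      have : (1 : ℝ) ≤ ((2 * k : ℕ) : ℝ) := by exact_mod_cast hV1
      refine pow_le_pow_left₀ (by positivity) ?_ n
      nlinarith
    have h18 : (2 : ℝ) ^ (2 * k) * 2 ^ (3 * k - 1) < 2 ^ (3 * k) * 3 ^ (2 * k) := by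
      have e1 : (2 : ℝ) ^ (2 * k) < 3 ^ (2 * k) :=
        pow_lt_pow_left₀ (by norm_num) (by norm_num) (by omega)
      have e2 : (2 : ℝ) ^ (3 * k - 1) ≤ 2 ^ (3 * k) := pow_le_pow_right₀ (by norm_num) (by omega)
      rw [mul_comm ((2 : ℝ) ^ (3 * k))]
      exact mul_lt_mul e1 e2 (by positivity) (by positivity)
    set t := (8 / 3 : ℝ) ^ ((((3 * k : ℕ) : ℝ) - 1) / 2)
    have hpos : 0 < ((3 * k : ℕ) : ℝ) ^ n * (2 * ((2 * k : ℕ) : ℝ)) ^ n := by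
      have : (0 : ℝ) < ((2 * k : ℕ) : ℝ) := by exact_mod_cast hV1
      positivity
    calc (2 : ℝ) ^ (2 * k) * 10 ^ m * (2 * ((3 * k : ℕ) : ℝ)) ^ n
        ≤ (2 : ℝ) ^ (2 * k) * (2 ^ (3 * k - 1) * t) *
          (((3 * k : ℕ) : ℝ) ^ n * (2 * ((2 * k : ℕ) : ℝ)) ^ n) := by gcongr
      _ = ((2 : ℝ) ^ (2 * k) * 2 ^ (3 * k - 1)) *
          (t * (((3 * k : ℕ) : ℝ) ^ n * (2 * ((2 * k : ℕ) : ℝ)) ^ n)) := by ring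
      _ < (2 ^ (3 * k) * 3 ^ (2 * k)) *
          (t * (((3 * k : ℕ) : ℝ) ^ n * (2 * ((2 * k : ℕ) : ℝ)) ^ n)) :=
        mul_lt_mul_of_pos_right h18 (mul_pos h83 hpos)
      _ = _ := by ring
  · subst hn1
    obtain ⟨j, rfl⟩ : ∃ j, g = j + 1 := ⟨g - 1, by omega⟩
    obtain rfl : m = 3 * j + 1 := by omega
    obtain rfl : V = 4 * j + 2 := by omega
    obtain rfl : N = 6 * j + 3 := by omega
    have hexp : ((((6 * j + 3 : ℕ) : ℝ) - 1) / 2) = ((3 * j + 1 : ℕ) : ℝ) := by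
      push_cast
      ring
    have hz : (4 * ((j + 1 : ℕ) : ℤ) - 2) = ((4 * j + 2 : ℕ) : ℤ) := by
      push_cast
      ring
    rw [hexp, Real.rpow_natCast, hz, zpow_natCast, pow_one]
    have key : (10 : ℝ) ^ (3 * j + 1) * 2 < 3 ^ (4 * j + 2) * (8 / 3 : ℝ) ^ (3 * j + 1) := by
      have e1 : (10 : ℝ) ^ (3 * j + 1) * 2 = 1000 ^ j * 20 := by
        rw [pow_succ, pow_mul]
        norm_num
        ring
      have e2 : (3 : ℝ) ^ (4 * j + 2) * (8 / 3 : ℝ) ^ (3 * j + 1) = 1536 ^ j * 24 := by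
        rw [pow_add, pow_mul, pow_succ (8 / 3 : ℝ), pow_mul (8 / 3 : ℝ), show (1536 : ℝ) ^ j
          = (3 ^ 4) ^ j * ((8 / 3) ^ 3) ^ j by rw [← mul_pow]; norm_num]
        ring
      rw [e1, e2]
      have e3 : (1000 : ℝ) ^ j ≤ 1536 ^ j := pow_le_pow_left₀ (by norm_num) (by norm_num) j
      have e4 : (0 : ℝ) < 1536 ^ j := by positivity
      linarith
    set t : ℝ := ((6 * j + 3 : ℕ) : ℝ)
    calc (2 : ℝ) ^ (4 * j + 2) * 10 ^ (3 * j + 1) * (2 * t)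
        = (10 ^ (3 * j + 1) * 2) * (2 ^ (4 * j + 2) * t) := by ring
      _ < (3 ^ (4 * j + 2) * (8 / 3 : ℝ) ^ (3 * j + 1)) * (2 ^ (4 * j + 2) * t) :=
        mul_lt_mul_of_pos_right key (by positivity)
      _ = _ := by ring
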